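/- **Syntax.** Kinds are generated by $*$ and $\kappa_1\Rightarrow\kappa_2$. Type constructors are the well-kinded expressions (up to $\alpha$-conversion) generated by: infinitely many variables $\alpha:\kappa$ of each kind $\kappa$; one constant $\mathtt{nat}:*$; $\varphi\psi:\kappa_2$ for $\varphi:\kappa_1\Rightarrow\kappa_2$, $\psi:\kappa_1$; $\lambda\alpha{:}\kappa_1.\varphi:\kappa_1\Rightarrow\kappa_2$ for $\varphi:\kappa_2$; and $\sigma\to\tau:*$, $\forall\alpha{:}\kappa.\sigma:*$ for $\sigma,\tau:*$. Type constructors of kind $*$ are *types*; $=_\beta$ is the $\beta$-conversion generated by $(\lambda\alpha.\varphi)\psi\to\varphi[\alpha:=\psi]$. Let $\chi_*=\mathtt{nat}$ and $\chi_{\kappa_1\Rightarrow\kappa_2}=\lambda\alpha{:}\kappa_1.\chi_{\kappa_2}$. The function symbols are $n:\mathtt{nat}$ ($n\in\mathbb N$), $\oplus,\otimes:\forall\alpha.\alpha\to\alpha\to\alpha$, $\mathtt{flatten}:\forall\alpha.\alpha\to\mathtt{nat}$ and $\mathtt{lift}:\forall\alpha.\mathtt{nat}\to\alpha$. Preterms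 are the Church-style expressions (up to $\alpha$-conversion) that are typable by the rules of System $\mathtt F_\omega$: typed variables; function symbols; $\lambda x{:}\sigma.s:\sigma\to\tau$ if $x:\sigma$ and $s:\tau$; $\Lambda\alpha{:}\kappa.s:\forall\alpha{:}\kappa.\sigma$ if $s:\sigma$ and $\alpha$ is not free in the type of a free variable of $s$; $s\cdot t:\tau$ if $s:\sigma\to\tau$ and $t:\sigma$; $s*\varphi:\sigma[\alpha:=\varphi]$ if $s:\forall\alpha{:}\kappa.\sigma$ and $\varphi:\kappa$; and $s:\tau$ if $s:\tau'$ and $\tau=_\beta\tau'$. *Interpretation terms* are the equivalence classes of preterms modulo $\beta$-conversion in the types occurring in them. Write $f_\tau$ for $f*\tau$. **Reduction.** Let $\leadsto$ be the smallest relation on interpretation terms that is closed under $\lambda x{:}\sigma.\_$, $\Lambda\alpha{:}\kappa.\_$, $u\cdot\_$, $\_\cdot u$ and $\_*\varphi$ and satisfies, for $\circ\in\{\oplus,\otimes\}$ and $x,\alpha$ fresh for $s,t$ in the rules for $\circ$ and $\mathtt{lift}$: - $(\lambda x{:}\sigma.s)\cdot t\leadsto s[x:=t]$ and $(\Lambda\alpha{:}\kappa.s)*\varphi\leadsto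 s[\alpha:=\varphi]$; - $\oplus_{\mathtt{nat}}\cdot n\cdot m\leadsto n+m$ and $\otimes_{\mathtt{nat}}\cdot n\cdot m\leadsto nm$ for $n,m\in\mathbb N$; - $\circ_{\sigma\to\tau}\cdot s\cdot t\leadsto\lambda x{:}\sigma.\circ_\tau\cdot(s\cdot x)\cdot(t\cdot x)$; - $\circ_{\forall\alpha:\kappa.\sigma}\cdot s\cdot t\leadsto\Lambda\alpha{:}\kappa.\circ_\sigma\cdot(s*\alpha)\cdot(t*\alpha)$; - $\mathtt{flatten}_{\mathtt{nat}}\cdot s\leadsto s$; - $\mathtt{flatten}_{\sigma\to\tau}\cdot s\leadsto\mathtt{flatten}_\tau\cdot(s\cdot(\mathtt{lift}_\sigma\cdot 0))$; - $\mathtt{flatten}_{\forall\alpha:\kappa.\sigma}\cdot s\leadsto\mathtt{flatten}_{\sigma[\alpha:=\chi_\kappa]}\cdot(s*\chi_\kappa)$; - $\mathtt{lift}_{\mathtt{nat}}\cdot s\leadsto s$; - $\mathtt{lift}_{\sigma\to\tau}\cdot s\leadsto\lambda x{:}\sigma.\mathtt{lift}_\tau\cdot s$; - $\mathtt{lift}_{\forall\alpha:\kappa.\sigma}\cdot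 s\leadsto\Lambda\alpha{:}\kappa.\mathtt{lift}_\sigma\cdot s$. **Theorem (strong normalisation).** If $t$ is an interpretation term, open or closed, of some type $\sigma$, then $t$ is terminating with respect to $\leadsto$: there is no infinite sequence $t=t_0\leadsto t_1\leadsto t_2\leadsto\cdots$. -/

import Mathlib

namespace FOmegaNat

/-! ### Kinds, type constructors and their beta-conversion -/

/-- Kinds: `∗` and `κ₁ ⇒ κ₂`. -/
inductive Kind : Type
  | star : Kind
  | arr : Kind → Kind → Kind

/-- Type constructor variables of kind `κ` available in the (finite) list `Δ` of kinds of the type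
constructor variables in scope: well-kinded de Bruijn indices. -/
inductive TVar : List Kind → Kind → Type
  | zero {Δ : List Kind} {κ : Kind} : TVar (κ :: Δ) κ
  | succ {Δ : List Kind} {κ κ' : Kind} : TVar Δ κ → TVar (κ' :: Δ) κ

/-- Type constructors of kind `κ` over the single type constructor symbol `nat : ∗`, with free
variables in `Δ`, up to alpha-conversion. Type constructors of kind `∗` are the types. -/
inductive TyCon : List Kind → Kind → Type
  | var {Δ : List Kind} {κ : Kind} : TVar Δ κ → TyCon Δ κ
  | nat {Δ : List Kind} : TyCon Δ Kind.star
  | arrow {Δ : List Kind} : TyCon Δ Kind.star → TyCon Δ Kind.star → TyCon Δ Kind.star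
  | all {Δ : List Kind} (κ : Kind) : TyCon (κ :: Δ) Kind.star → TyCon Δ Kind.star
  | lam {Δ : List Kind} (κ₁ : Kind) {κ₂ : Kind} : TyCon (κ₁ :: Δ) κ₂ → TyCon Δ (Kind.arr κ₁ κ₂)
  | app {Δ : List Kind} {κ₁ κ₂ : Kind} :
      TyCon Δ (Kind.arr κ₁ κ₂) → TyCon Δ κ₁ → TyCon Δ κ₂

/-- Interpretation types with free variables in `Δ`. -/
abbrev Ty (Δ : List Kind) : Type := TyCon Δ Kind.star

/-- Kind-preserving renamings of type constructor variables. -/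
abbrev TRen (Δ Δ' : List Kind) : Type := ∀ κ : Kind, TVar Δ κ → TVar Δ' κ

/-- Kind-preserving substitutions for type constructor variables. -/
abbrev TSub (Δ Δ' : List Kind) : Type := ∀ κ : Kind, TVar Δ κ → TyCon Δ' κ

/-- Extension of a renaming under a binder. -/
def TRen.up {Δ Δ' : List Kind} (ρ : TRen Δ Δ') (κ₀ : Kind) : TRen (κ₀ :: Δ) (κ₀ :: Δ')
  | _, TVar.zero => TVar.zero
  | κ, TVar.succ α => TVar.succ (ρ κ α)

/-- Weakening by one fresh variable. -/
def TRen.shift (Δ : List Kind) (κ₀ : Kind) : TRen Δ (κ₀ :: Δ) := fun _ α => TVar.succ α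

def TyCon.rename : {Δ Δ' : List Kind} → {κ : Kind} → TRen Δ Δ' → TyCon Δ κ → TyCon Δ' κ
  | _, _, κ, ρ, TyCon.var α => TyCon.var (ρ κ α)
  | _, _, _, _, TyCon.nat => TyCon.nat
  | _, _, _, ρ, TyCon.arrow σ τ => TyCon.arrow (σ.rename ρ) (τ.rename ρ)
  | _, _, _, ρ, TyCon.all κ σ => TyCon.all κ (σ.rename (ρ.up κ))
  | _, _, _, ρ, TyCon.lam κ φ => TyCon.lam κ (φ.rename (ρ.up κ))
  | _, _, _, ρ, TyCon.app φ ψ => TyCon.app (φ.rename ρ) (ψ.rename ρ)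

/-- Weakening of a type constructor by one fresh variable of kind `κ₀`. -/
def TyCon.weaken {Δ : List Kind} {κ : Kind} (κ₀ : Kind) (φ : TyCon Δ κ) : TyCon (κ₀ :: Δ) κ :=
  φ.rename (TRen.shift Δ κ₀)

/-- Extension of a substitution under a binder. -/
def TSub.up {Δ Δ' : List Kind} (θ : TSub Δ Δ') (κ₀ : Kind) : TSub (κ₀ :: Δ) (κ₀ :: Δ')
  | _, TVar.zero => TyCon.var TVar.zero
  | κ, TVar.succ α => (θ κ α).weaken κ₀

/-- The substitution that replaces the variable with index `0` by `ψ`. -/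
def TSub.single {Δ : List Kind} {κ₀ : Kind} (ψ : TyCon Δ κ₀) : TSub (κ₀ :: Δ) Δ
  | _, TVar.zero => ψ
  | _, TVar.succ α => TyCon.var α

def TyCon.subst : {Δ Δ' : List Kind} → {κ : Kind} → TSub Δ Δ' → TyCon Δ κ → TyCon Δ' κ
  | _, _, κ, θ, TyCon.var α => θ κ α
  | _, _, _, _, TyCon.nat => TyCon.nat
  | _, _, _, θ, TyCon.arrow σ τ => TyCon.arrow (σ.subst θ) (τ.subst θ)
  | _, _, _, θ, TyCon.all κ σ => TyCon.all κ (σ.subst (θ.up κ))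
  | _, _, _, θ, TyCon.lam κ φ => TyCon.lam κ (φ.subst (θ.up κ))
  | _, _, _, θ, TyCon.app φ ψ => TyCon.app (φ.subst θ) (ψ.subst θ)

/-- `φ[α := ψ]`, where `α` is the variable with index `0`. -/
def TyCon.inst {Δ : List Kind} {κ₀ κ : Kind} (φ : TyCon (κ₀ :: Δ) κ) (ψ : TyCon Δ κ₀) :
    TyCon Δ κ :=
  φ.subst (TSub.single ψ)

/-- One-step beta-reduction of type constructors: the compatible closure of
`(λα.φ)ψ → φ[α := ψ]`. -/
inductive TyCon.BetaStep : {Δ : List Kind} → {κ : Kind} → TyCon Δ κ → TyCon Δ κ → Prop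
  | beta {Δ : List Kind} {κ₁ κ₂ : Kind} (φ : TyCon (κ₁ :: Δ) κ₂) (ψ : TyCon Δ κ₁) :
      TyCon.BetaStep (TyCon.app (TyCon.lam κ₁ φ) ψ) (φ.inst ψ)
  | arrow_left {Δ : List Kind} {σ σ' : Ty Δ} (τ : Ty Δ) :
      TyCon.BetaStep σ σ' → TyCon.BetaStep (TyCon.arrow σ τ) (TyCon.arrow σ' τ)
  | arrow_right {Δ : List Kind} (σ : Ty Δ) {τ τ' : Ty Δ} :
      TyCon.BetaStep τ τ' → TyCon.BetaStep (TyCon.arrow σ τ) (TyCon.arrow σ τ')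
  | all {Δ : List Kind} {κ : Kind} {σ σ' : Ty (κ :: Δ)} :
      TyCon.BetaStep σ σ' → TyCon.BetaStep (TyCon.all κ σ) (TyCon.all κ σ')
  | lam {Δ : List Kind} {κ₁ κ₂ : Kind} {φ φ' : TyCon (κ₁ :: Δ) κ₂} :
      TyCon.BetaStep φ φ' → TyCon.BetaStep (TyCon.lam κ₁ φ) (TyCon.lam κ₁ φ')
  | app_left {Δ : List Kind} {κ₁ κ₂ : Kind} {φ φ' : TyCon Δ (Kind.arr κ₁ κ₂)} (ψ : TyCon Δ κ₁) :
      TyCon.BetaStep φ φ' → TyCon.BetaStep (TyCon.app φ ψ) (TyCon.app φ' ψ)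
  | app_right {Δ : List Kind} {κ₁ κ₂ : Kind} (φ : TyCon Δ (Kind.arr κ₁ κ₂)) {ψ ψ' : TyCon Δ κ₁} :
      TyCon.BetaStep ψ ψ' → TyCon.BetaStep (TyCon.app φ ψ) (TyCon.app φ ψ')

/-- Beta-conversion `φ =β ψ`: the equivalence relation generated by beta-reduction. -/
def TyCon.BetaEq {Δ : List Kind} {κ : Kind} : TyCon Δ κ → TyCon Δ κ → Prop :=
  Relation.EqvGen TyCon.BetaStep

/-- The closed type constructors `χ_κ`: `χ_∗ = nat` and `χ_(κ₁ ⇒ κ₂) = λα:κ₁. χ_κ₂`. -/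
def TyCon.chi : {Δ : List Kind} → (κ : Kind) → TyCon Δ κ
  | _, Kind.star => TyCon.nat
  | _, Kind.arr κ₁ κ₂ => TyCon.lam κ₁ (TyCon.chi κ₂)

/-! ### Preterms and typing -/

/-- The function symbols. -/
inductive FSym : Type
  | num : ℕ → FSym
  | plus : FSym
  | times : FSym
  | flatten : FSym
  | lift : FSym

/-- The closed type of each function symbol:
`n : nat`, `⊕, ⊗ : ∀α. α → α → α`, `flatten : ∀α. α → nat`, `lift : ∀α. nat → α`. -/
def FSym.type {Δ : List Kind} : FSym → Ty Δ
  | FSym.num _ => TyCon.nat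
  | FSym.plus | FSym.times =>
      TyCon.all Kind.star (TyCon.arrow (TyCon.var TVar.zero)
        (TyCon.arrow (TyCon.var TVar.zero) (TyCon.var TVar.zero)))
  | FSym.flatten => TyCon.all Kind.star (TyCon.arrow (TyCon.var TVar.zero) TyCon.nat)
  | FSym.lift => TyCon.all Kind.star (TyCon.arrow TyCon.nat (TyCon.var TVar.zero))

/-- Church-style expressions up to alpha-conversion, with free type constructor variables in `Δ`.
Term variables are de Bruijn indices. The preterms are those expressions that have a type
(see `HasType`). -/
inductive Tm : List Kind → Type
  | var {Δ : List Kind} : ℕ → Tm Δ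
  | sym {Δ : List Kind} : FSym → Tm Δ
  | abs {Δ : List Kind} : Ty Δ → Tm Δ → Tm Δ
  | tabs {Δ : List Kind} (κ : Kind) : Tm (κ :: Δ) → Tm Δ
  | app {Δ : List Kind} : Tm Δ → Tm Δ → Tm Δ
  | tapp {Δ : List Kind} {κ : Kind} : Tm Δ → TyCon Δ κ → Tm Δ

/-- `HasType Γ s σ`: the expression `s` has type `σ` when the free term variable with index `i`
has the type at position `i` of `Γ`. In the rule `tabs` the types of the free variables of `s` are
weakened, so the abstracted variable does not occur in them. -/
inductive HasType : {Δ : List Kind} → List (Ty Δ) → Tm Δ → Ty Δ → Prop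
  | var {Δ : List Kind} {Γ : List (Ty Δ)} {i : ℕ} {σ : Ty Δ} :
      Γ[i]? = some σ → HasType Γ (Tm.var i) σ
  | sym {Δ : List Kind} {Γ : List (Ty Δ)} (f : FSym) : HasType Γ (Tm.sym f) f.type
  | abs {Δ : List Kind} {Γ : List (Ty Δ)} {σ τ : Ty Δ} {s : Tm Δ} :
      HasType (σ :: Γ) s τ → HasType Γ (Tm.abs σ s) (TyCon.arrow σ τ)
  | tabs {Δ : List Kind} {Γ : List (Ty Δ)} {κ : Kind} {σ : Ty (κ :: Δ)} {s : Tm (κ :: Δ)} :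
      HasType (Γ.map (TyCon.weaken κ)) s σ → HasType Γ (Tm.tabs κ s) (TyCon.all κ σ)
  | app {Δ : List Kind} {Γ : List (Ty Δ)} {σ τ : Ty Δ} {s t : Tm Δ} :
      HasType Γ s (TyCon.arrow σ τ) → HasType Γ t σ → HasType Γ (Tm.app s t) τ
  | tapp {Δ : List Kind} {Γ : List (Ty Δ)} {κ : Kind} {σ : Ty (κ :: Δ)} {s : Tm Δ}
      (φ : TyCon Δ κ) :
      HasType Γ s (TyCon.all κ σ) → HasType Γ (Tm.tapp s φ) (σ.inst φ)
  | conv {Δ : List Kind} {Γ : List (Ty Δ)} {σ σ' : Ty Δ} {s : Tm Δ} :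
      HasType Γ s σ' → σ.BetaEq σ' → HasType Γ s σ

/-! ### Renaming and substitution in expressions -/

/-- Extension of a renaming of term variables under a binder. -/
def renUp (ρ : ℕ → ℕ) : ℕ → ℕ
  | 0 => 0
  | i + 1 => ρ i + 1

/-- Renaming of term variables. -/
def Tm.rename : {Δ : List Kind} → (ℕ → ℕ) → Tm Δ → Tm Δ
  | _, ρ, Tm.var i => Tm.var (ρ i)
  | _, _, Tm.sym f => Tm.sym f
  | _, ρ, Tm.abs σ s => Tm.abs σ (s.rename (renUp ρ))
  | _, ρ, Tm.tabs κ s => Tm.tabs κ (s.rename ρ)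
  | _, ρ, Tm.app s t => Tm.app (s.rename ρ) (t.rename ρ)
  | _, ρ, Tm.tapp s φ => Tm.tapp (s.rename ρ) φ

/-- Weakening by one fresh term variable. -/
def Tm.weaken {Δ : List Kind} (s : Tm Δ) : Tm Δ := s.rename Nat.succ

/-- Renaming of type constructor variables in an expression. -/
def Tm.trename : {Δ Δ' : List Kind} → TRen Δ Δ' → Tm Δ → Tm Δ'
  | _, _, _, Tm.var i => Tm.var i
  | _, _, _, Tm.sym f => Tm.sym f
  | _, _, ρ, Tm.abs σ s => Tm.abs (σ.rename ρ) (s.trename ρ)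
  | _, _, ρ, Tm.tabs κ s => Tm.tabs κ (s.trename (ρ.up κ))
  | _, _, ρ, Tm.app s t => Tm.app (s.trename ρ) (t.trename ρ)
  | _, _, ρ, Tm.tapp s φ => Tm.tapp (s.trename ρ) (φ.rename ρ)

/-- Weakening by one fresh type constructor variable. -/
def Tm.tweaken {Δ : List Kind} (κ₀ : Kind) (s : Tm Δ) : Tm (κ₀ :: Δ) :=
  s.trename (TRen.shift Δ κ₀)

/-- Substitution for type constructor variables in an expression. -/
def Tm.tsubst : {Δ Δ' : List Kind} → TSub Δ Δ' → Tm Δ → Tm Δ'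
  | _, _, _, Tm.var i => Tm.var i
  | _, _, _, Tm.sym f => Tm.sym f
  | _, _, θ, Tm.abs σ s => Tm.abs (σ.subst θ) (s.tsubst θ)
  | _, _, θ, Tm.tabs κ s => Tm.tabs κ (s.tsubst (θ.up κ))
  | _, _, θ, Tm.app s t => Tm.app (s.tsubst θ) (t.tsubst θ)
  | _, _, θ, Tm.tapp s φ => Tm.tapp (s.tsubst θ) (φ.subst θ)

/-- `s[α := ψ]`, where `α` is the type constructor variable with index `0`. -/
def Tm.tinst {Δ : List Kind} {κ₀ : Kind} (s : Tm (κ₀ :: Δ)) (ψ : TyCon Δ κ₀) : Tm Δ :=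
  s.tsubst (TSub.single ψ)

/-- Extension of a term substitution under a binder of a term variable. -/
def subUp {Δ : List Kind} (γ : ℕ → Tm Δ) : ℕ → Tm Δ
  | 0 => Tm.var 0
  | i + 1 => (γ i).weaken

/-- Capture-avoiding substitution for term variables. -/
def Tm.subst : {Δ : List Kind} → (ℕ → Tm Δ) → Tm Δ → Tm Δ
  | _, γ, Tm.var i => γ i
  | _, _, Tm.sym f => Tm.sym f
  | _, γ, Tm.abs σ s => Tm.abs σ (s.subst (subUp γ))
  | _, γ, Tm.tabs κ s => Tm.tabs κ (s.subst (fun i => (γ i).tweaken κ))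
  | _, γ, Tm.app s t => Tm.app (s.subst γ) (t.subst γ)
  | _, γ, Tm.tapp s φ => Tm.tapp (s.subst γ) φ

/-- The substitution that replaces the term variable with index `0` by `t`. -/
def subSingle {Δ : List Kind} (t : Tm Δ) : ℕ → Tm Δ
  | 0 => t
  | i + 1 => Tm.var i

/-- `s[x := t]`, where `x` is the term variable with index `0`. -/
def Tm.inst {Δ : List Kind} (s t : Tm Δ) : Tm Δ := s.subst (subSingle t)

/-! ### Terms: preterms modulo beta-conversion in types -/

/-- `s ≡ t`: the expressions are identical modulo beta-conversion in types. -/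
inductive Tm.Equiv : {Δ : List Kind} → Tm Δ → Tm Δ → Prop
  | var {Δ : List Kind} (i : ℕ) : Tm.Equiv (Tm.var i : Tm Δ) (Tm.var i)
  | sym {Δ : List Kind} (f : FSym) : Tm.Equiv (Tm.sym f : Tm Δ) (Tm.sym f)
  | abs {Δ : List Kind} {σ σ' : Ty Δ} {s s' : Tm Δ} :
      σ.BetaEq σ' → Tm.Equiv s s' → Tm.Equiv (Tm.abs σ s) (Tm.abs σ' s')
  | tabs {Δ : List Kind} {κ : Kind} {s s' : Tm (κ :: Δ)} :
      Tm.Equiv s s' → Tm.Equiv (Tm.tabs κ s) (Tm.tabs κ s')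
  | app {Δ : List Kind} {s s' t t' : Tm Δ} :
      Tm.Equiv s s' → Tm.Equiv t t' → Tm.Equiv (Tm.app s t) (Tm.app s' t')
  | tapp {Δ : List Kind} {κ : Kind} {s s' : Tm Δ} {φ φ' : TyCon Δ κ} :
      Tm.Equiv s s' → φ.BetaEq φ' → Tm.Equiv (Tm.tapp s φ) (Tm.tapp s' φ')

theorem Tm.Equiv.rfl' {Δ : List Kind} (s : Tm Δ) : Tm.Equiv s s := by
  induction s with
  | var i => exact .var i
  | sym f => exact .sym f
  | abs σ s ih => exact .abs (.refl _) ih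
  | tabs κ s ih => exact .tabs ih
  | app s t ihs iht => exact .app ihs iht
  | tapp s φ ih => exact .tapp ih (.refl _)

theorem Tm.Equiv.symm' {Δ : List Kind} {s t : Tm Δ} (h : Tm.Equiv s t) : Tm.Equiv t s := by
  induction h with
  | var i => exact .var i
  | sym f => exact .sym f
  | abs hσ _ ih => exact .abs (.symm _ _ hσ) ih
  | tabs _ ih => exact .tabs ih
  | app _ _ ihs iht => exact .app ihs iht
  | tapp _ hφ ih => exact .tapp ih (.symm _ _ hφ)

theorem Tm.Equiv.trans' {Δ : List Kind} {s t u : Tm Δ} (h : Tm.Equiv s t) (h' : Tm.Equiv t u) :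
    Tm.Equiv s u := by
  induction h with
  | var i => exact h'
  | sym f => exact h'
  | abs hσ _ ih => cases h' with | abs hσ' h₂ => exact .abs (.trans _ _ _ hσ hσ') (ih h₂)
  | tabs _ ih => cases h' with | tabs h₂ => exact .tabs (ih h₂)
  | app _ _ ihs iht => cases h' with | app h₁ h₂ => exact .app (ihs h₁) (iht h₂)
  | tapp _ hφ ih => cases h' with | tapp h₂ hφ' => exact .tapp (ih h₂) (.trans _ _ _ hφ hφ')

instance Tm.setoid (Δ : List Kind) : Setoid (Tm Δ) where
  r := Tm.Equiv
  iseqv := ⟨Tm.Equiv.rfl', Tm.Equiv.symm', Tm.Equiv.trans'⟩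

/-- Equivalence classes of expressions modulo `≡`. The interpretation terms are the typable
ones. -/
def ITerm (Δ : List Kind) : Type := Quotient (Tm.setoid Δ)

/-- The equivalence class of an expression. -/
def ITerm.mk {Δ : List Kind} (s : Tm Δ) : ITerm Δ := Quotient.mk (Tm.setoid Δ) s

/-- `a` is an interpretation term of type `σ` when its free variables have the types in `Γ`. -/
def ITerm.HasType {Δ : List Kind} (Γ : List (Ty Δ)) (a : ITerm Δ) (σ : Ty Δ) : Prop :=
  ∃ s : Tm Δ, ITerm.mk s = a ∧ FOmegaNat.HasType Γ s σ

/-! ### The reduction relation -/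

/-- The two binary symbols `⊕` and `⊗`. -/
inductive FSym.IsBinary : FSym → Prop
  | plus : FSym.IsBinary FSym.plus
  | times : FSym.IsBinary FSym.times

/-- `f_τ s`, that is `(f * τ) · s`. -/
def Tm.fapp {Δ : List Kind} (f : FSym) (τ : Ty Δ) (s : Tm Δ) : Tm Δ :=
  Tm.app (Tm.tapp (Tm.sym f) τ) s

/-- `f_τ s t`, that is `((f * τ) · s) · t`. -/
def Tm.fapp₂ {Δ : List Kind} (f : FSym) (τ : Ty Δ) (s t : Tm Δ) : Tm Δ :=
  Tm.app (Tm.fapp f τ s) t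

/-- The numeral `n`. -/
def Tm.num {Δ : List Kind} (n : ℕ) : Tm Δ := Tm.sym (FSym.num n)

/-- The reduction rules on representatives. -/
inductive Tm.Step : {Δ : List Kind} → Tm Δ → Tm Δ → Prop
  | abs {Δ : List Kind} (σ : Ty Δ) {s t : Tm Δ} :
      Tm.Step s t → Tm.Step (Tm.abs σ s) (Tm.abs σ t)
  | tabs {Δ : List Kind} (κ : Kind) {s t : Tm (κ :: Δ)} :
      Tm.Step s t → Tm.Step (Tm.tabs κ s) (Tm.tabs κ t)
  | app_right {Δ : List Kind} (u : Tm Δ) {s t : Tm Δ} :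
      Tm.Step s t → Tm.Step (Tm.app u s) (Tm.app u t)
  | app_left {Δ : List Kind} (u : Tm Δ) {s t : Tm Δ} :
      Tm.Step s t → Tm.Step (Tm.app s u) (Tm.app t u)
  | tapp {Δ : List Kind} {κ : Kind} (φ : TyCon Δ κ) {s t : Tm Δ} :
      Tm.Step s t → Tm.Step (Tm.tapp s φ) (Tm.tapp t φ)
  | beta {Δ : List Kind} (σ : Ty Δ) (s t : Tm Δ) :
      Tm.Step (Tm.app (Tm.abs σ s) t) (s.inst t)
  | tbeta {Δ : List Kind} {κ : Kind} (s : Tm (κ :: Δ)) (φ : TyCon Δ κ) :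
      Tm.Step (Tm.tapp (Tm.tabs κ s) φ) (s.tinst φ)
  | plus_nat {Δ : List Kind} (n m : ℕ) :
      Tm.Step (Tm.fapp₂ FSym.plus TyCon.nat (Tm.num n) (Tm.num m) : Tm Δ) (Tm.num (n + m))
  | times_nat {Δ : List Kind} (n m : ℕ) :
      Tm.Step (Tm.fapp₂ FSym.times TyCon.nat (Tm.num n) (Tm.num m) : Tm Δ) (Tm.num (n * m))
  | circ_arrow {Δ : List Kind} {f : FSym} (hf : f.IsBinary) (σ τ : Ty Δ) (s t : Tm Δ) :
      Tm.Step (Tm.fapp₂ f (TyCon.arrow σ τ) s t)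
        (Tm.abs σ (Tm.fapp₂ f τ (Tm.app s.weaken (Tm.var 0)) (Tm.app t.weaken (Tm.var 0))))
  | circ_all {Δ : List Kind} {f : FSym} (hf : f.IsBinary) (κ : Kind) (σ : Ty (κ :: Δ))
      (s t : Tm Δ) :
      Tm.Step (Tm.fapp₂ f (TyCon.all κ σ) s t)
        (Tm.tabs κ (Tm.fapp₂ f σ (Tm.tapp (s.tweaken κ) (TyCon.var (TVar.zero (κ := κ))))
          (Tm.tapp (t.tweaken κ) (TyCon.var (TVar.zero (κ := κ))))))
  | flatten_nat {Δ : List Kind} (s : Tm Δ) :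
      Tm.Step (Tm.fapp FSym.flatten TyCon.nat s) s
  | flatten_arrow {Δ : List Kind} (σ τ : Ty Δ) (s : Tm Δ) :
      Tm.Step (Tm.fapp FSym.flatten (TyCon.arrow σ τ) s)
        (Tm.fapp FSym.flatten τ (Tm.app s (Tm.fapp FSym.lift σ (Tm.num 0))))
  | flatten_all {Δ : List Kind} (κ : Kind) (σ : Ty (κ :: Δ)) (s : Tm Δ) :
      Tm.Step (Tm.fapp FSym.flatten (TyCon.all κ σ) s)
        (Tm.fapp FSym.flatten (σ.inst (TyCon.chi κ)) (Tm.tapp s (TyCon.chi κ : TyCon Δ κ)))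
  | lift_nat {Δ : List Kind} (s : Tm Δ) :
      Tm.Step (Tm.fapp FSym.lift TyCon.nat s) s
  | lift_arrow {Δ : List Kind} (σ τ : Ty Δ) (s : Tm Δ) :
      Tm.Step (Tm.fapp FSym.lift (TyCon.arrow σ τ) s)
        (Tm.abs σ (Tm.fapp FSym.lift τ s.weaken))
  | lift_all {Δ : List Kind} (κ : Kind) (σ : Ty (κ :: Δ)) (s : Tm Δ) :
      Tm.Step (Tm.fapp FSym.lift (TyCon.all κ σ) s)
        (Tm.tabs κ (Tm.fapp FSym.lift σ (s.tweaken κ)))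

/-- The relation `⇝` on terms (equivalence classes of `≡`): the rules may be applied to any
representative. -/
def ITerm.Step {Δ : List Kind} (a b : ITerm Δ) : Prop :=
  ∃ s t : Tm Δ, ITerm.mk s = a ∧ ITerm.mk t = b ∧ Tm.Step s t

/-- `a` is terminating: there is no infinite reduction `a ⇝ a₁ ⇝ a₂ ⇝ ⋯`. -/
def ITerm.Terminating {Δ : List Kind} (a : ITerm Δ) : Prop :=
  ¬ ∃ r : ℕ → ITerm Δ, r 0 = a ∧ ∀ n : ℕ, ITerm.Step (r n) (r (n + 1))

end FOmegaNat

/-!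
Strong normalisation is proved with Girard's reducibility candidates, taken as sets of *untyped*
expressions without free type constructor variables, so that neither subject reduction nor any
typing invariant is needed.

Reduction of equivalence classes is first replaced by a relation `Tm.Red` on expressions whose
rules for function symbols fire when the type argument is beta-convertible to the required shape;
`Tm.Step.exists_red` shows that it simulates `ITerm.Step`. Confluence of beta-reduction on type
constructors (`TyCon.BetaEq.join`) shows that at most one shape is possible, with components
determined up to conversion.

A candidate for a closed type `τ` (`IsCandidate`) is a saturated set that is moreover closed under
`⊕_τ`, `⊗_τ` and `lift_τ`, and on which `flatten_τ` is strongly normalising. This is how the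
type-directed rules enter: the function symbols then belong to the values of their polymorphic
types by definition, and the work lies in showing that arrows and quantifiers preserve the closure
conditions (`isCandidate_arrowSet`, `isCandidate_allSet`). In the rule for `flatten` at `∀α:κ.σ`,
the argument is instantiated at `χ_κ`, which has a semantic counterpart by `exists_realizes_chi`.

The value of a type constructor (`interp`) is a set or a higher-order function on sets and does not
mention syntactic types, so beta-convertible type constructors have equal values. The syntactic
type only enters through the logical relation `Realizes`, which extends "`X` is a candidate for
`τ`" to all kinds and bounds the quantification in the value of `∀α:κ.σ`. The fundamental lemmas
`realizes_interp` and `HasType.subst_mem_interp` put every substitution instance of a typable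
expression in the value of its type. Instantiating with variables and with the `χ_κ` gives the
result, as strong normalisation is reflected by substitution.
-/

namespace FOmegaNat

/-! ### Substitution calculus for type constructors -/

/-- Extension of a substitution for type constructor variables by the image of the variable with
index `0`. -/
def TSub.cons {Δ Δ' : List Kind} {κ₀ : Kind} (ψ : TyCon Δ' κ₀) (θ : TSub Δ Δ') :
    TSub (κ₀ :: Δ) Δ'
  | _, TVar.zero => ψ
  | κ, TVar.succ α => θ κ α

theorem TSub.cons_var {Δ : List Kind} {κ₀ : Kind} (ψ : TyCon Δ κ₀) :
    TSub.cons ψ (fun _ α => TyCon.var α) = TSub.single ψ := by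
  funext κ α
  cases α <;> rfl

theorem TSub.up_var (Δ : List Kind) (κ₀ : Kind) :
    TSub.up (fun κ (α : TVar Δ κ) => TyCon.var α) κ₀ = fun _ α => TyCon.var α := by
  funext κ α
  cases α <;> rfl

theorem TyCon.subst_var {Δ : List Kind} {κ : Kind} (φ : TyCon Δ κ) :
    φ.subst (fun _ α => TyCon.var α) = φ := by
  induction φ <;> simp_all [TyCon.subst, TSub.up_var]

theorem TyCon.rename_rename {Δ₁ Δ₂ Δ₃ : List Kind} {κ : Kind} (φ : TyCon Δ₁ κ)
    (ρ : TRen Δ₁ Δ₂) (ρ' : TRen Δ₂ Δ₃) :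
    (φ.rename ρ).rename ρ' = φ.rename (fun κ α => ρ' κ (ρ κ α)) := by
  have up {Δ₁ Δ₂ Δ₃ : List Kind} (ρ : TRen Δ₁ Δ₂) (ρ' : TRen Δ₂ Δ₃) (κ₀ : Kind) :
      TRen.up (fun κ α => ρ' κ (ρ κ α)) κ₀ = fun κ α => ρ'.up κ₀ κ (ρ.up κ₀ κ α) := by
    funext κ α
    cases α <;> rfl
  induction φ generalizing Δ₂ Δ₃ with
  | var | nat => rfl
  | arrow _ _ h₁ h₂ | app _ _ h₁ h₂ => simp only [TyCon.rename, h₁, h₂]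
  | all _ _ h | lam _ _ h => simp only [TyCon.rename, h, up ρ ρ']

theorem TyCon.subst_rename {Δ₁ Δ₂ Δ₃ : List Kind} {κ : Kind} (φ : TyCon Δ₁ κ)
    (ρ : TRen Δ₁ Δ₂) (θ : TSub Δ₂ Δ₃) :
    (φ.rename ρ).subst θ = φ.subst (fun κ α => θ κ (ρ κ α)) := by
  have up {Δ₁ Δ₂ Δ₃ : List Kind} (ρ : TRen Δ₁ Δ₂) (θ : TSub Δ₂ Δ₃) (κ₀ : Kind) :
      TSub.up (fun κ α => θ κ (ρ κ α)) κ₀ = fun κ α => θ.up κ₀ κ (ρ.up κ₀ κ α) := by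
    funext κ α
    cases α <;> rfl
  induction φ generalizing Δ₂ Δ₃ with
  | var | nat => rfl
  | arrow _ _ h₁ h₂ | app _ _ h₁ h₂ => simp only [TyCon.rename, TyCon.subst, h₁, h₂]
  | all _ _ h | lam _ _ h => simp only [TyCon.rename, TyCon.subst, h, up ρ θ]

theorem TSub.up_rename {Δ₁ Δ₂ Δ₃ : List Kind} (θ : TSub Δ₁ Δ₂) (ρ : TRen Δ₂ Δ₃) (κ₀ : Kind) :
    TSub.up (fun κ α => (θ κ α).rename ρ) κ₀ =
      fun κ α => (θ.up κ₀ κ α).rename (ρ.up κ₀) := by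
  funext κ α
  cases α with
  | zero => rfl
  | succ α => simp [TSub.up, TyCon.weaken, TyCon.rename_rename, TRen.shift, TRen.up]

theorem TyCon.rename_subst {Δ₁ Δ₂ Δ₃ : List Kind} {κ : Kind} (φ : TyCon Δ₁ κ)
    (θ : TSub Δ₁ Δ₂) (ρ : TRen Δ₂ Δ₃) :
    (φ.subst θ).rename ρ = φ.subst (fun κ α => (θ κ α).rename ρ) := by
  induction φ generalizing Δ₂ Δ₃ <;> simp_all [TyCon.rename, TyCon.subst, TSub.up_rename]

theorem TyCon.subst_weaken {Δ Δ' : List Kind} {κ κ₀ : Kind} (φ : TyCon Δ κ) (θ : TSub Δ Δ') :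
    (φ.weaken κ₀).subst (θ.up κ₀) = (φ.subst θ).weaken κ₀ := by
  simp only [TyCon.weaken, TyCon.subst_rename, TyCon.rename_subst]
  rfl

theorem TSub.up_subst {Δ₁ Δ₂ Δ₃ : List Kind} (θ : TSub Δ₁ Δ₂) (θ' : TSub Δ₂ Δ₃) (κ₀ : Kind) :
    TSub.up (fun κ α => (θ κ α).subst θ') κ₀ = fun κ α => (θ.up κ₀ κ α).subst (θ'.up κ₀) := by
  funext κ α
  cases α with
  | zero => rfl
  | succ α => simp [TSub.up, TyCon.subst_weaken]

theorem TyCon.subst_subst {Δ₁ Δ₂ Δ₃ : List Kind} {κ : Kind} (φ : TyCon Δ₁ κ)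
    (θ : TSub Δ₁ Δ₂) (θ' : TSub Δ₂ Δ₃) :
    (φ.subst θ).subst θ' = φ.subst (fun κ α => (θ κ α).subst θ') := by
  induction φ generalizing Δ₂ Δ₃ <;> simp_all [TyCon.subst, TSub.up_subst]

theorem TyCon.subst_cons_weaken {Δ Δ' : List Kind} {κ κ₀ : Kind} (φ : TyCon Δ κ)
    (ψ : TyCon Δ' κ₀) (θ : TSub Δ Δ') :
    (φ.weaken κ₀).subst (TSub.cons ψ θ) = φ.subst θ := by
  simp only [TyCon.weaken, TyCon.subst_rename]
  rfl

theorem TyCon.inst_weaken {Δ : List Kind} {κ κ₀ : Kind} (φ : TyCon Δ κ) (ψ : TyCon Δ κ₀) :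
    (φ.weaken κ₀).inst ψ = φ := by
  rw [TyCon.inst, ← TSub.cons_var, TyCon.subst_cons_weaken, TyCon.subst_var]

theorem TSub.inst_up {Δ Δ' : List Kind} {κ₀ : Kind} (ψ : TyCon Δ' κ₀) (θ : TSub Δ Δ') :
    (fun κ α => (θ.up κ₀ κ α).inst ψ) = TSub.cons ψ θ := by
  funext κ α
  cases α with
  | zero => rfl
  | succ α => exact TyCon.inst_weaken _ _

theorem TyCon.inst_subst_up {Δ Δ' : List Kind} {κ κ₀ : Kind} (φ : TyCon (κ₀ :: Δ) κ)
    (ψ : TyCon Δ' κ₀) (θ : TSub Δ Δ') :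
    (φ.subst (θ.up κ₀)).inst ψ = φ.subst (TSub.cons ψ θ) := by
  rw [TyCon.inst, TyCon.subst_subst, ← TSub.inst_up]
  rfl

theorem TyCon.subst_inst {Δ Δ' : List Kind} {κ κ₀ : Kind} (φ : TyCon (κ₀ :: Δ) κ)
    (ψ : TyCon Δ κ₀) (θ : TSub Δ Δ') :
    (φ.inst ψ).subst θ = (φ.subst (θ.up κ₀)).inst (ψ.subst θ) := by
  rw [TyCon.inst_subst_up, TyCon.inst, TyCon.subst_subst]
  congr 1
  funext κ α
  cases α <;> rfl

theorem TyCon.rename_eq_subst {Δ Δ' : List Kind} {κ : Kind} (φ : TyCon Δ κ) (ρ : TRen Δ Δ') :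
    φ.rename ρ = φ.subst (fun κ α => TyCon.var (ρ κ α)) := by
  conv_lhs => rw [← TyCon.subst_var φ]
  rw [TyCon.rename_subst]
  rfl

theorem TyCon.subst_chi {Δ Δ' : List Kind} (κ : Kind) (θ : TSub Δ Δ') :
    (TyCon.chi κ : TyCon Δ κ).subst θ = TyCon.chi κ := by
  induction κ generalizing Δ Δ' <;> simp_all [TyCon.chi, TyCon.subst]

/-! ### Beta-conversion of type constructors -/

namespace TyCon

/-- A map of type constructors that preserves single beta-steps preserves beta-conversion. -/
theorem BetaEq.map {Δ Δ' : List Kind} {κ κ' : Kind} (f : TyCon Δ κ → TyCon Δ' κ')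
    (hf : ∀ φ ψ, BetaStep φ ψ → BetaStep (f φ) (f ψ)) {φ ψ : TyCon Δ κ} (h : BetaEq φ ψ) :
    BetaEq (f φ) (f ψ) := by
  induction h with
  | rel _ _ h => exact .rel _ _ (hf _ _ h)
  | refl => exact .refl _
  | symm _ _ _ ih => exact .symm _ _ ih
  | trans _ _ _ _ _ ih₁ ih₂ => exact .trans _ _ _ ih₁ ih₂

theorem BetaEq.rfl {Δ : List Kind} {κ : Kind} {φ : TyCon Δ κ} : BetaEq φ φ := .refl _

theorem BetaEq.symm {Δ : List Kind} {κ : Kind} {φ ψ : TyCon Δ κ} (h : BetaEq φ ψ) :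
    BetaEq ψ φ := Relation.EqvGen.symm _ _ h

theorem BetaEq.trans {Δ : List Kind} {κ : Kind} {φ ψ χ : TyCon Δ κ} (h : BetaEq φ ψ)
    (h' : BetaEq ψ χ) : BetaEq φ χ := Relation.EqvGen.trans _ _ _ h h'

theorem BetaEq.app {Δ : List Kind} {κ₁ κ₂ : Kind} {φ φ' : TyCon Δ (Kind.arr κ₁ κ₂)}
    {ψ ψ' : TyCon Δ κ₁} (h : BetaEq φ φ') (h' : BetaEq ψ ψ') :
    BetaEq (TyCon.app φ ψ) (TyCon.app φ' ψ') :=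
  (h.map (fun φ => TyCon.app φ ψ) fun _ _ => .app_left _).trans (h'.map _ fun _ _ => .app_right _)

theorem BetaEq.arrow {Δ : List Kind} {σ σ' τ τ' : Ty Δ} (h : BetaEq σ σ') (h' : BetaEq τ τ') :
    BetaEq (arrow σ τ) (arrow σ' τ') :=
  (h.map (fun σ => TyCon.arrow σ τ) fun _ _ => .arrow_left _).trans (h'.map _ fun _ _ => .arrow_right _)

theorem BetaEq.all {Δ : List Kind} {κ : Kind} {σ σ' : Ty (κ :: Δ)} (h : BetaEq σ σ') :
    BetaEq (all κ σ) (all κ σ') := h.map _ fun _ _ => .all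

theorem BetaEq.lam {Δ : List Kind} {κ κ' : Kind} {φ φ' : TyCon (κ :: Δ) κ'} (h : BetaEq φ φ') :
    BetaEq (lam κ φ) (lam κ φ') := h.map _ fun _ _ => .lam

theorem BetaStep.subst {Δ Δ' : List Kind} {κ : Kind} {φ φ' : TyCon Δ κ} (h : BetaStep φ φ')
    (θ : TSub Δ Δ') : BetaStep (φ.subst θ) (φ'.subst θ) := by
  induction h generalizing Δ' with
  | beta φ ψ => rw [subst_inst]; exact .beta _ _
  | arrow_left τ _ ih => exact .arrow_left _ (ih θ)
  | arrow_right σ _ ih => exact .arrow_right _ (ih θ)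
  | all _ ih => exact .all (ih _)
  | lam _ ih => exact .lam (ih _)
  | app_left ψ _ ih => exact .app_left _ (ih θ)
  | app_right φ _ ih => exact .app_right _ (ih θ)

theorem BetaEq.subst {Δ Δ' : List Kind} {κ : Kind} {φ φ' : TyCon Δ κ} (h : BetaEq φ φ')
    (θ : TSub Δ Δ') : BetaEq (φ.subst θ) (φ'.subst θ) :=
  h.map (fun φ => φ.subst θ) fun _ _ h => h.subst θ

theorem BetaEq.rename {Δ Δ' : List Kind} {κ : Kind} {φ φ' : TyCon Δ κ} (h : BetaEq φ φ')
    (ρ : TRen Δ Δ') : BetaEq (φ.rename ρ) (φ'.rename ρ) := by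
  simpa only [rename_eq_subst] using h.subst _

theorem BetaEq.subst_right {Δ Δ' : List Kind} {κ : Kind} (φ : TyCon Δ κ)
    {θ θ' : TSub Δ Δ'} (h : ∀ κ α, BetaEq (θ κ α) (θ' κ α)) :
    BetaEq (φ.subst θ) (φ.subst θ') := by
  have up {Δ Δ' : List Kind} (κ₀ : Kind) {θ θ' : TSub Δ Δ'}
      (h : ∀ κ α, BetaEq (θ κ α) (θ' κ α)) (κ : Kind) (α : TVar (κ₀ :: Δ) κ) :
      BetaEq (θ.up κ₀ κ α) (θ'.up κ₀ κ α) := by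
    cases α with
    | zero => exact .rfl
    | succ α => exact (h _ α).rename _
  induction φ generalizing Δ' with
  | var α => exact h _ α
  | nat => exact .rfl
  | arrow σ τ ih₁ ih₂ => exact .arrow (ih₁ h) (ih₂ h)
  | all κ σ ih => exact .all (ih (up κ h))
  | lam κ φ ih => exact .lam (ih (up κ h))
  | app φ ψ ih₁ ih₂ => exact .app (ih₁ h) (ih₂ h)

theorem BetaEq.inst {Δ : List Kind} {κ κ₀ : Kind} {φ φ' : TyCon (κ₀ :: Δ) κ} {ψ ψ' : TyCon Δ κ₀}
    (h : BetaEq φ φ') (h' : BetaEq ψ ψ') : BetaEq (φ.inst ψ) (φ'.inst ψ') := by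
  refine (h.subst _).trans (BetaEq.subst_right _ fun κ α => ?_)
  cases α with
  | zero => exact h'
  | succ α => exact .rfl

/-- Parallel beta-reduction of type constructors. -/
inductive ParStep : {Δ : List Kind} → {κ : Kind} → TyCon Δ κ → TyCon Δ κ → Prop
  | var {Δ : List Kind} {κ : Kind} (α : TVar Δ κ) : ParStep (.var α) (.var α)
  | nat {Δ : List Kind} : ParStep (.nat : Ty Δ) .nat
  | arrow {Δ : List Kind} {σ σ' τ τ' : Ty Δ} :
      ParStep σ σ' → ParStep τ τ' → ParStep (.arrow σ τ) (.arrow σ' τ')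
  | all {Δ : List Kind} {κ : Kind} {σ σ' : Ty (κ :: Δ)} :
      ParStep σ σ' → ParStep (.all κ σ) (.all κ σ')
  | lam {Δ : List Kind} {κ₁ κ₂ : Kind} {φ φ' : TyCon (κ₁ :: Δ) κ₂} :
      ParStep φ φ' → ParStep (.lam κ₁ φ) (.lam κ₁ φ')
  | app {Δ : List Kind} {κ₁ κ₂ : Kind} {φ φ' : TyCon Δ (Kind.arr κ₁ κ₂)} {ψ ψ' : TyCon Δ κ₁} :
      ParStep φ φ' → ParStep ψ ψ' → ParStep (.app φ ψ) (.app φ' ψ')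
  | beta {Δ : List Kind} {κ₁ κ₂ : Kind} {φ φ' : TyCon (κ₁ :: Δ) κ₂} {ψ ψ' : TyCon Δ κ₁} :
      ParStep φ φ' → ParStep ψ ψ' → ParStep (.app (.lam κ₁ φ) ψ) (φ'.inst ψ')

theorem ParStep.refl {Δ : List Kind} {κ : Kind} (φ : TyCon Δ κ) : ParStep φ φ := by
  induction φ with
  | var α => exact .var α
  | nat => exact .nat
  | arrow _ _ h₁ h₂ => exact .arrow h₁ h₂
  | all _ _ h => exact .all h
  | lam _ _ h => exact .lam h
  | app _ _ h₁ h₂ => exact .app h₁ h₂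

theorem BetaStep.parStep {Δ : List Kind} {κ : Kind} {φ ψ : TyCon Δ κ} (h : BetaStep φ ψ) :
    ParStep φ ψ := by
  induction h with
  | beta φ ψ => exact .beta (.refl _) (.refl _)
  | arrow_left τ _ ih => exact .arrow ih (.refl _)
  | arrow_right σ _ ih => exact .arrow (.refl _) ih
  | all _ ih => exact .all ih
  | lam _ ih => exact .lam ih
  | app_left ψ _ ih => exact .app ih (.refl _)
  | app_right φ _ ih => exact .app (.refl _) ih

theorem ParStep.betaEq {Δ : List Kind} {κ : Kind} {φ ψ : TyCon Δ κ} (h : ParStep φ ψ) :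
    BetaEq φ ψ := by
  induction h with
  | var α => exact .rfl
  | nat => exact .rfl
  | arrow _ _ h₁ h₂ => exact .arrow h₁ h₂
  | all _ h => exact .all h
  | lam _ h => exact .lam h
  | app _ _ h₁ h₂ => exact .app h₁ h₂
  | beta _ _ h₁ h₂ => exact .trans (.rel _ _ (.beta _ _)) (.inst h₁ h₂)

theorem ParStep.subst_left {Δ Δ' : List Kind} {κ : Kind} {φ φ' : TyCon Δ κ} (h : ParStep φ φ')
    (θ : TSub Δ Δ') : ParStep (φ.subst θ) (φ'.subst θ) := by
  induction h generalizing Δ' with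
  | var α => exact .refl _
  | nat => exact .nat
  | arrow _ _ h₁ h₂ => exact .arrow (h₁ θ) (h₂ θ)
  | all _ h => exact .all (h _)
  | lam _ h => exact .lam (h _)
  | app _ _ h₁ h₂ => exact .app (h₁ θ) (h₂ θ)
  | beta _ _ h₁ h₂ => rw [subst_inst]; exact .beta (h₁ _) (h₂ θ)

theorem ParStep.subst {Δ Δ' : List Kind} {κ : Kind} {φ φ' : TyCon Δ κ} (h : ParStep φ φ')
    {θ θ' : TSub Δ Δ'} (hθ : ∀ κ α, ParStep (θ κ α) (θ' κ α)) :
    ParStep (φ.subst θ) (φ'.subst θ') := by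
  have up {Δ Δ' : List Kind} (κ₀ : Kind) {θ θ' : TSub Δ Δ'}
      (h : ∀ κ α, ParStep (θ κ α) (θ' κ α)) (κ : Kind) (α : TVar (κ₀ :: Δ) κ) :
      ParStep (θ.up κ₀ κ α) (θ'.up κ₀ κ α) := by
    cases α with
    | zero => exact .var _
    | succ α => simpa only [TSub.up, weaken, rename_eq_subst] using (h _ α).subst_left _
  induction h generalizing Δ' with
  | var α => exact hθ _ α
  | nat => exact .nat
  | arrow _ _ h₁ h₂ => exact .arrow (h₁ hθ) (h₂ hθ)
  | all _ h => exact .all (h (up _ hθ))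
  | lam _ h => exact .lam (h (up _ hθ))
  | app _ _ h₁ h₂ => exact .app (h₁ hθ) (h₂ hθ)
  | beta _ _ h₁ h₂ => rw [subst_inst]; exact .beta (h₁ (up _ hθ)) (h₂ hθ)

theorem ParStep.inst {Δ : List Kind} {κ κ₀ : Kind} {φ φ' : TyCon (κ₀ :: Δ) κ}
    {ψ ψ' : TyCon Δ κ₀} (h : ParStep φ φ') (h' : ParStep ψ ψ') :
    ParStep (φ.inst ψ) (φ'.inst ψ') := by
  refine h.subst fun κ α => ?_
  cases α with
  | zero => exact h'
  | succ α => exact .var _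

theorem ParStep.diamond {Δ : List Kind} {κ : Kind} {φ φ₁ φ₂ : TyCon Δ κ} (h₁ : ParStep φ φ₁)
    (h₂ : ParStep φ φ₂) : ∃ ψ, ParStep φ₁ ψ ∧ ParStep φ₂ ψ := by
  induction h₁ with
  | var α => exact ⟨_, h₂, .refl _⟩
  | nat => exact ⟨_, h₂, .refl _⟩
  | arrow _ _ ih₁ ih₂ =>
    cases h₂ with
    | arrow a b =>
      obtain ⟨_, a₁, a₂⟩ := ih₁ a
      obtain ⟨_, b₁, b₂⟩ := ih₂ b
      exact ⟨_, .arrow a₁ b₁, .arrow a₂ b₂⟩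
  | all _ ih =>
    cases h₂ with
    | all a =>
      obtain ⟨_, a₁, a₂⟩ := ih a
      exact ⟨_, .all a₁, .all a₂⟩
  | lam _ ih =>
    cases h₂ with
    | lam a =>
      obtain ⟨_, a₁, a₂⟩ := ih a
      exact ⟨_, .lam a₁, .lam a₂⟩
  | app h _ ih₁ ih₂ =>
    cases h₂ with
    | app a b =>
      obtain ⟨_, a₁, a₂⟩ := ih₁ a
      obtain ⟨_, b₁, b₂⟩ := ih₂ b
      exact ⟨_, .app a₁ b₁, .app a₂ b₂⟩
    | beta a b =>
      obtain ⟨_, a₁, a₂⟩ := ih₁ (.lam a)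
      obtain ⟨_, b₁, b₂⟩ := ih₂ b
      cases h with
      | lam h =>
        cases a₁ with
        | lam a₁ =>
          cases a₂ with
          | lam a₂ => exact ⟨_, .beta a₁ b₁, .inst a₂ b₂⟩
  | beta _ _ ih₁ ih₂ =>
    cases h₂ with
    | app a b =>
      cases a with
      | lam a =>
        obtain ⟨_, a₁, a₂⟩ := ih₁ a
        obtain ⟨_, b₁, b₂⟩ := ih₂ b
        exact ⟨_, .inst a₁ b₁, .beta a₂ b₂⟩
    | beta a b =>
      obtain ⟨_, a₁, a₂⟩ := ih₁ a
      obtain ⟨_, b₁, b₂⟩ := ih₂ b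
      exact ⟨_, .inst a₁ b₁, .inst a₂ b₂⟩

/-- Church-Rosser for type constructors. -/
theorem BetaEq.join {Δ : List Kind} {κ : Kind} {φ ψ : TyCon Δ κ} (h : BetaEq φ ψ) :
    Relation.Join (Relation.ReflTransGen ParStep) φ ψ := by
  have equiv := Relation.equivalence_join_reflTransGen (r := @ParStep Δ κ) fun a b c h₁ h₂ =>
    have ⟨d, hb, hc⟩ := h₁.diamond h₂
    ⟨d, .single hb, .single hc⟩
  induction h with
  | rel _ _ h => exact ⟨_, .single h.parStep, .refl⟩
  | refl => exact equiv.refl _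
  | symm _ _ _ ih => exact equiv.symm ih
  | trans _ _ _ _ _ ih₁ ih₂ => exact equiv.trans ih₁ ih₂

theorem parSteps_nat {Δ : List Kind} {φ : Ty Δ}
    (h : Relation.ReflTransGen ParStep nat φ) : φ = nat := by
  induction h with
  | refl => rfl
  | tail _ h ih => subst ih; cases h; rfl

theorem parSteps_arrow {Δ : List Kind} {σ τ φ : Ty Δ}
    (h : Relation.ReflTransGen ParStep (arrow σ τ) φ) :
    ∃ σ' τ', φ = arrow σ' τ' ∧ BetaEq σ σ' ∧ BetaEq τ τ' := by
  induction h with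
  | refl => exact ⟨_, _, rfl, .rfl, .rfl⟩
  | tail _ h ih =>
    obtain ⟨σ', τ', rfl, h₁, h₂⟩ := ih
    cases h with
    | arrow a b => exact ⟨_, _, rfl, h₁.trans a.betaEq, h₂.trans b.betaEq⟩

theorem parSteps_all {Δ : List Kind} {κ : Kind} {σ : Ty (κ :: Δ)} {φ : Ty Δ}
    (h : Relation.ReflTransGen ParStep (all κ σ) φ) :
    ∃ σ', φ = all κ σ' ∧ BetaEq σ σ' := by
  induction h with
  | refl => exact ⟨_, rfl, .rfl⟩
  | tail _ h ih =>
    obtain ⟨σ', rfl, h₁⟩ := ih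
    cases h with
    | all a => exact ⟨_, rfl, h₁.trans a.betaEq⟩

theorem not_betaEq_nat_arrow {Δ : List Kind} {σ τ : Ty Δ} : ¬ BetaEq nat (arrow σ τ) := by
  intro h
  obtain ⟨φ, h₁, h₂⟩ := h.join
  obtain ⟨_, _, rfl, -⟩ := parSteps_arrow h₂
  cases parSteps_nat h₁

theorem not_betaEq_nat_all {Δ : List Kind} {κ : Kind} {σ : Ty (κ :: Δ)} :
    ¬ BetaEq nat (all κ σ) := by
  intro h
  obtain ⟨φ, h₁, h₂⟩ := h.join
  obtain ⟨_, rfl, -⟩ := parSteps_all h₂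
  cases parSteps_nat h₁

theorem not_betaEq_arrow_all {Δ : List Kind} {σ τ : Ty Δ} {κ : Kind} {ρ : Ty (κ :: Δ)} :
    ¬ BetaEq (arrow σ τ) (all κ ρ) := by
  intro h
  obtain ⟨φ, h₁, h₂⟩ := h.join
  obtain ⟨_, rfl, -⟩ := parSteps_all h₂
  obtain ⟨_, _, h, -⟩ := parSteps_arrow h₁
  cases h

theorem BetaEq.arrow_inj {Δ : List Kind} {σ τ σ' τ' : Ty Δ}
    (h : BetaEq (TyCon.arrow σ τ) (TyCon.arrow σ' τ')) : BetaEq σ σ' ∧ BetaEq τ τ' := by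
  obtain ⟨φ, h₁, h₂⟩ := h.join
  obtain ⟨_, _, rfl, a, b⟩ := parSteps_arrow h₁
  obtain ⟨_, _, h, a', b'⟩ := parSteps_arrow h₂
  cases h
  exact ⟨a.trans a'.symm, b.trans b'.symm⟩

theorem BetaEq.all_kind {Δ : List Kind} {κ κ' : Kind} {σ : Ty (κ :: Δ)} {σ' : Ty (κ' :: Δ)}
    (h : BetaEq (TyCon.all κ σ) (TyCon.all κ' σ')) : κ = κ' := by
  obtain ⟨φ, h₁, h₂⟩ := h.join
  obtain ⟨_, rfl, -⟩ := parSteps_all h₁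
  obtain ⟨_, h, -⟩ := parSteps_all h₂
  cases h
  rfl

theorem BetaEq.all_inj {Δ : List Kind} {κ : Kind} {σ σ' : Ty (κ :: Δ)}
    (h : BetaEq (TyCon.all κ σ) (TyCon.all κ σ')) : BetaEq σ σ' := by
  obtain ⟨φ, h₁, h₂⟩ := h.join
  obtain ⟨_, rfl, a⟩ := parSteps_all h₁
  obtain ⟨_, h, a'⟩ := parSteps_all h₂
  cases h
  exact a.trans a'.symm

end TyCon

/-! ### Substitution calculus for expressions -/

namespace Tm

theorem tsubst_var {Δ : List Kind} (s : Tm Δ) : s.tsubst (fun _ α => TyCon.var α) = s := by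
  induction s <;> simp_all [tsubst, TyCon.subst_var, TSub.up_var]

theorem tsubst_tsubst {Δ₁ Δ₂ Δ₃ : List Kind} (s : Tm Δ₁) (θ : TSub Δ₁ Δ₂) (θ' : TSub Δ₂ Δ₃) :
    (s.tsubst θ).tsubst θ' = s.tsubst (fun κ α => (θ κ α).subst θ') := by
  induction s generalizing Δ₂ Δ₃ <;> simp_all [tsubst, TyCon.subst_subst, TSub.up_subst]

theorem trename_eq_tsubst {Δ Δ' : List Kind} (s : Tm Δ) (ρ : TRen Δ Δ') :
    s.trename ρ = s.tsubst (fun κ α => TyCon.var (ρ κ α)) := by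
  have up {Δ Δ' : List Kind} (ρ : TRen Δ Δ') (κ₀ : Kind) :
      (fun κ α => TyCon.var (ρ.up κ₀ κ α)) = TSub.up (fun κ α => TyCon.var (ρ κ α)) κ₀ := by
    funext κ α
    cases α <;> rfl
  induction s generalizing Δ' with
  | var | sym => rfl
  | abs _ _ h | tapp _ _ h => simp only [trename, tsubst, TyCon.rename_eq_subst, h]
  | tabs _ _ h => simp only [trename, tsubst, h, up ρ]
  | app _ _ h₁ h₂ => simp only [trename, tsubst, h₁, h₂]

theorem tsubst_tweaken {Δ Δ' : List Kind} {κ₀ : Kind} (s : Tm Δ) (θ : TSub Δ Δ') :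
    (s.tweaken κ₀).tsubst (θ.up κ₀) = (s.tsubst θ).tweaken κ₀ := by
  simp only [tweaken, trename_eq_tsubst, tsubst_tsubst, ← TyCon.rename_eq_subst]
  rfl

theorem tinst_tweaken {Δ : List Kind} {κ₀ : Kind} (s : Tm Δ) (ψ : TyCon Δ κ₀) :
    (s.tweaken κ₀).tinst ψ = s := by
  rw [tweaken, trename_eq_tsubst, tinst, tsubst_tsubst]
  exact tsubst_var s

theorem tinst_tsubst_up {Δ Δ' : List Kind} {κ₀ : Kind} (s : Tm (κ₀ :: Δ))
    (ψ : TyCon Δ' κ₀) (θ : TSub Δ Δ') :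
    (s.tsubst (θ.up κ₀)).tinst ψ = s.tsubst (TSub.cons ψ θ) := by
  rw [tinst, tsubst_tsubst, ← TSub.inst_up]
  rfl

theorem tsubst_tinst {Δ Δ' : List Kind} {κ₀ : Kind} (s : Tm (κ₀ :: Δ))
    (ψ : TyCon Δ κ₀) (θ : TSub Δ Δ') :
    (s.tinst ψ).tsubst θ = (s.tsubst (θ.up κ₀)).tinst (ψ.subst θ) := by
  rw [tinst_tsubst_up, tinst, tsubst_tsubst]
  congr 1
  funext κ α
  cases α <;> rfl

theorem tsubst_rename {Δ Δ' : List Kind} (s : Tm Δ) (ρ : ℕ → ℕ) (θ : TSub Δ Δ') :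
    (s.rename ρ).tsubst θ = (s.tsubst θ).rename ρ := by
  induction s generalizing Δ' ρ <;> simp_all [rename, tsubst]

theorem tsubst_weaken {Δ Δ' : List Kind} (s : Tm Δ) (θ : TSub Δ Δ') :
    s.weaken.tsubst θ = (s.tsubst θ).weaken := tsubst_rename s _ θ

theorem rename_tweaken {Δ : List Kind} {κ : Kind} (s : Tm Δ) (ρ : ℕ → ℕ) :
    (s.tweaken κ).rename ρ = (s.rename ρ).tweaken κ := by
  simp only [tweaken, trename_eq_tsubst, tsubst_rename]

theorem tsubst_subst {Δ Δ' : List Kind} (s : Tm Δ) (γ : ℕ → Tm Δ) (θ : TSub Δ Δ') :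
    (s.subst γ).tsubst θ = (s.tsubst θ).subst (fun i => (γ i).tsubst θ) := by
  have up {Δ Δ' : List Kind} (γ : ℕ → Tm Δ) (θ : TSub Δ Δ') :
      (fun i => (subUp γ i).tsubst θ) = subUp (fun i => (γ i).tsubst θ) := by
    funext i
    cases i with
    | zero => rfl
    | succ i => exact tsubst_weaken _ _
  induction s generalizing Δ' with
  | var | sym => rfl
  | abs _ _ h => simp only [subst, tsubst, h, up]
  | tapp _ _ h => simp only [subst, tsubst, h]
  | tabs _ _ h => simp only [subst, tsubst, h, tsubst_tweaken]
  | app _ _ h₁ h₂ => simp only [subst, tsubst, h₁, h₂]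

theorem subst_tweaken {Δ : List Kind} {κ : Kind} (s : Tm Δ) (γ : ℕ → Tm Δ) :
    (s.tweaken κ).subst (fun i => (γ i).tweaken κ) = (s.subst γ).tweaken κ := by
  simp only [tweaken, trename_eq_tsubst, tsubst_subst]

theorem subst_tinst {Δ : List Kind} {κ : Kind} (s : Tm (κ :: Δ)) (γ : ℕ → Tm Δ)
    (ψ : TyCon Δ κ) :
    (s.subst (fun i => (γ i).tweaken κ)).tinst ψ = (s.tinst ψ).subst γ := by
  refine (tsubst_subst s _ (TSub.single ψ)).trans ?_
  exact congrArg (fun γ => (s.tinst ψ).subst γ) (funext fun i => tinst_tweaken (γ i) ψ)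

theorem subst_var {Δ : List Kind} (s : Tm Δ) : s.subst Tm.var = s := by
  have up {Δ : List Kind} : subUp (Tm.var : ℕ → Tm Δ) = Tm.var := by
    funext i
    cases i <;> rfl
  induction s with
  | var | sym => rfl
  | abs _ _ h => rw [subst, up, h]
  | tapp _ _ h => rw [subst, h]
  | tabs _ _ h => exact congrArg _ h
  | app _ _ h₁ h₂ => rw [subst, h₁, h₂]

theorem rename_rename {Δ : List Kind} (s : Tm Δ) (ρ ρ' : ℕ → ℕ) :
    (s.rename ρ).rename ρ' = s.rename (fun i => ρ' (ρ i)) := by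
  have up (ρ ρ' : ℕ → ℕ) : renUp (fun i => ρ' (ρ i)) = fun i => renUp ρ' (renUp ρ i) := by
    funext i
    cases i <;> rfl
  induction s generalizing ρ ρ' with
  | var | sym => rfl
  | abs _ _ h => simp only [rename, h, up ρ ρ']
  | tapp _ _ h | tabs _ _ h => simp only [rename, h]
  | app _ _ h₁ h₂ => simp only [rename, h₁, h₂]

theorem subst_rename {Δ : List Kind} (s : Tm Δ) (ρ : ℕ → ℕ) (γ : ℕ → Tm Δ) :
    (s.rename ρ).subst γ = s.subst (fun i => γ (ρ i)) := by
  have up {Δ : List Kind} (ρ : ℕ → ℕ) (γ : ℕ → Tm Δ) :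
      subUp (fun i => γ (ρ i)) = fun i => subUp γ (renUp ρ i) := by
    funext i
    cases i <;> rfl
  induction s generalizing ρ with
  | var | sym => rfl
  | abs _ _ h => simp only [rename, subst, h, up ρ γ]
  | tapp _ _ h | tabs _ _ h => simp only [rename, subst, h]
  | app _ _ h₁ h₂ => simp only [rename, subst, h₁, h₂]

theorem rename_subst {Δ : List Kind} (s : Tm Δ) (γ : ℕ → Tm Δ) (ρ : ℕ → ℕ) :
    (s.subst γ).rename ρ = s.subst (fun i => (γ i).rename ρ) := by
  have up {Δ : List Kind} (γ : ℕ → Tm Δ) (ρ : ℕ → ℕ) :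
      subUp (fun i => (γ i).rename ρ) = fun i => (subUp γ i).rename (renUp ρ) := by
    funext i
    cases i with
    | zero => rfl
    | succ i => simp only [subUp, weaken, rename_rename]; rfl
  induction s generalizing ρ with
  | var | sym => rfl
  | abs _ _ h => simp only [rename, subst, h, up γ ρ]
  | tapp _ _ h => simp only [rename, subst, h]
  | tabs _ _ h => simp only [rename, subst, h, rename_tweaken]
  | app _ _ h₁ h₂ => simp only [rename, subst, h₁, h₂]

theorem subst_weaken {Δ : List Kind} (s : Tm Δ) (γ : ℕ → Tm Δ) :
    s.weaken.subst (subUp γ) = (s.subst γ).weaken := by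
  simp only [weaken, subst_rename, rename_subst]
  rfl

theorem subst_subst {Δ : List Kind} (s : Tm Δ) (γ γ' : ℕ → Tm Δ) :
    (s.subst γ).subst γ' = s.subst (fun i => (γ i).subst γ') := by
  have up {Δ : List Kind} (γ γ' : ℕ → Tm Δ) :
      subUp (fun i => (γ i).subst γ') = fun i => (subUp γ i).subst (subUp γ') := by
    funext i
    cases i with
    | zero => rfl
    | succ i => simp only [subUp, subst_weaken]
  induction s with
  | var | sym => rfl
  | abs _ _ h => simp only [subst, h, up γ γ']
  | tapp _ _ h => simp only [subst, h]
  | tabs _ _ h => simp only [subst, h, subst_tweaken]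
  | app _ _ h₁ h₂ => simp only [subst, h₁, h₂]

theorem inst_weaken {Δ : List Kind} (s t : Tm Δ) : s.weaken.inst t = s := by
  rw [weaken, inst, subst_rename]
  exact subst_var s

/-- Extension of a term substitution by the image of the variable with index `0`. -/
def _root_.FOmegaNat.subCons {Δ : List Kind} (t : Tm Δ) (γ : ℕ → Tm Δ) : ℕ → Tm Δ
  | 0 => t
  | i + 1 => γ i

theorem inst_subst_up {Δ : List Kind} (s t : Tm Δ) (γ : ℕ → Tm Δ) :
    (s.subst (subUp γ)).inst t = s.subst (subCons t γ) := by
  rw [inst, subst_subst]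
  congr 1
  funext i
  cases i with
  | zero => rfl
  | succ i => exact inst_weaken _ _

theorem subst_inst {Δ : List Kind} (s t : Tm Δ) (γ : ℕ → Tm Δ) :
    (s.inst t).subst γ = (s.subst (subUp γ)).inst (t.subst γ) := by
  rw [inst_subst_up, inst, subst_subst]
  congr 1
  funext i
  cases i <;> rfl

theorem tsubst_inst {Δ Δ' : List Kind} (s t : Tm Δ) (θ : TSub Δ Δ') :
    (s.inst t).tsubst θ = (s.tsubst θ).inst (t.tsubst θ) := by
  rw [inst, tsubst_subst, inst]
  congr 1
  funext i
  cases i <;> rfl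

/-! ### Beta-conversion in types is compatible with substitution -/

theorem Equiv.tsubst {Δ Δ' : List Kind} {s s' : Tm Δ} (h : Equiv s s') {θ θ' : TSub Δ Δ'}
    (hθ : ∀ κ α, TyCon.BetaEq (θ κ α) (θ' κ α)) : Equiv (s.tsubst θ) (s'.tsubst θ') := by
  have conv {Δ Δ' : List Kind} {θ θ' : TSub Δ Δ'} (hθ : ∀ κ α, TyCon.BetaEq (θ κ α) (θ' κ α))
      {κ : Kind} {φ φ' : TyCon Δ κ} (h : TyCon.BetaEq φ φ') :
      TyCon.BetaEq (φ.subst θ) (φ'.subst θ') := (h.subst θ).trans (.subst_right _ hθ)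
  induction h generalizing Δ' with
  | var i => exact .var i
  | sym f => exact .sym f
  | abs h _ ih => exact .abs (conv hθ h) (ih hθ)
  | tabs _ ih =>
    refine .tabs (ih fun κ α => ?_)
    cases α with
    | zero => exact .rfl
    | succ α => exact (hθ _ α).rename _
  | app _ _ ih₁ ih₂ => exact .app (ih₁ hθ) (ih₂ hθ)
  | tapp _ h ih => exact .tapp (ih hθ) (conv hθ h)

theorem Equiv.tinst {Δ : List Kind} {κ : Kind} {s s' : Tm (κ :: Δ)} {ψ ψ' : TyCon Δ κ}
    (h : Equiv s s') (h' : TyCon.BetaEq ψ ψ') : Equiv (s.tinst ψ) (s'.tinst ψ') := by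
  refine h.tsubst fun κ α => ?_
  cases α with
  | zero => exact h'
  | succ α => exact .rfl

theorem Equiv.tweaken {Δ : List Kind} {κ : Kind} {s s' : Tm Δ} (h : Equiv s s') :
    Equiv (s.tweaken κ) (s'.tweaken κ) := by
  simpa only [Tm.tweaken, trename_eq_tsubst] using h.tsubst fun _ _ => .rfl

theorem Equiv.rename {Δ : List Kind} {s s' : Tm Δ} (h : Equiv s s') (ρ : ℕ → ℕ) :
    Equiv (s.rename ρ) (s'.rename ρ) := by
  induction h generalizing ρ with
  | var i => exact .rfl' _
  | sym f => exact .sym f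
  | abs h _ ih => exact .abs h (ih _)
  | tabs _ ih => exact .tabs (ih ρ)
  | app _ _ ih₁ ih₂ => exact .app (ih₁ ρ) (ih₂ ρ)
  | tapp _ h ih => exact .tapp (ih ρ) h

theorem Equiv.weaken {Δ : List Kind} {s s' : Tm Δ} (h : Equiv s s') :
    Equiv s.weaken s'.weaken := h.rename _

theorem Equiv.subst {Δ : List Kind} {s s' : Tm Δ} (h : Equiv s s') {γ γ' : ℕ → Tm Δ}
    (hγ : ∀ i, Equiv (γ i) (γ' i)) : Equiv (s.subst γ) (s'.subst γ') := by
  induction h with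
  | var i => exact hγ i
  | sym f => exact .sym f
  | abs h _ ih =>
    refine .abs h (ih fun i => ?_)
    cases i with
    | zero => exact .var 0
    | succ i => exact (hγ i).weaken
  | tabs _ ih => exact .tabs (ih fun i => (hγ i).tweaken)
  | app _ _ ih₁ ih₂ => exact .app (ih₁ hγ) (ih₂ hγ)
  | tapp _ h ih => exact .tapp (ih hγ) h

theorem Equiv.inst {Δ : List Kind} {s s' t t' : Tm Δ} (h : Equiv s s') (h' : Equiv t t') :
    Equiv (s.inst t) (s'.inst t') := by
  refine h.subst fun i => ?_
  cases i with
  | zero => exact h'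
  | succ i => exact .var i

/-! ### Reduction of representatives modulo beta-conversion -/

/-- The reduction relation on representatives in which a rule for a function symbol fires as soon
as the type argument of the symbol is beta-convertible to the type required by the rule. It
simulates the reduction of equivalence classes while working on expressions only. -/
inductive Red : {Δ : List Kind} → Tm Δ → Tm Δ → Prop
  | abs {Δ : List Kind} (σ : Ty Δ) {s t : Tm Δ} : Red s t → Red (.abs σ s) (.abs σ t)
  | tabs {Δ : List Kind} (κ : Kind) {s t : Tm (κ :: Δ)} : Red s t → Red (.tabs κ s) (.tabs κ t)
  | app_right {Δ : List Kind} (u : Tm Δ) {s t : Tm Δ} : Red s t → Red (.app u s) (.app u t)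
  | app_left {Δ : List Kind} (u : Tm Δ) {s t : Tm Δ} : Red s t → Red (.app s u) (.app t u)
  | tapp {Δ : List Kind} {κ : Kind} (φ : TyCon Δ κ) {s t : Tm Δ} :
      Red s t → Red (.tapp s φ) (.tapp t φ)
  | beta {Δ : List Kind} (σ : Ty Δ) (s t : Tm Δ) : Red (.app (.abs σ s) t) (s.inst t)
  | tbeta {Δ : List Kind} {κ : Kind} (s : Tm (κ :: Δ)) (φ : TyCon Δ κ) :
      Red (.tapp (.tabs κ s) φ) (s.tinst φ)
  | plus_nat {Δ : List Kind} {ρ : Ty Δ} (h : ρ.BetaEq .nat) (n m : ℕ) :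
      Red (.app (.app (.tapp (.sym .plus) ρ) (.sym (.num n))) (.sym (.num m)))
        (.sym (.num (n + m)))
  | times_nat {Δ : List Kind} {ρ : Ty Δ} (h : ρ.BetaEq .nat) (n m : ℕ) :
      Red (.app (.app (.tapp (.sym .times) ρ) (.sym (.num n))) (.sym (.num m)))
        (.sym (.num (n * m)))
  | circ_arrow {Δ : List Kind} {f : FSym} (hf : f.IsBinary) {ρ σ τ : Ty Δ}
      (h : ρ.BetaEq (.arrow σ τ)) (s t : Tm Δ) :
      Red (.app (.app (.tapp (.sym f) ρ) s) t)
        (.abs σ (fapp₂ f τ (.app s.weaken (.var 0)) (.app t.weaken (.var 0))))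
  | circ_all {Δ : List Kind} {f : FSym} (hf : f.IsBinary) {κ : Kind} {ρ : Ty Δ} {σ : Ty (κ :: Δ)}
      (h : ρ.BetaEq (.all κ σ)) (s t : Tm Δ) :
      Red (.app (.app (.tapp (.sym f) ρ) s) t)
        (.tabs κ (fapp₂ f σ (.tapp (s.tweaken κ) (.var (.zero (κ := κ))))
          (.tapp (t.tweaken κ) (.var (.zero (κ := κ))))))
  | flatten_nat {Δ : List Kind} {ρ : Ty Δ} (h : ρ.BetaEq .nat) (s : Tm Δ) :
      Red (.app (.tapp (.sym .flatten) ρ) s) s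
  | flatten_arrow {Δ : List Kind} {ρ σ τ : Ty Δ} (h : ρ.BetaEq (.arrow σ τ)) (s : Tm Δ) :
      Red (.app (.tapp (.sym .flatten) ρ) s) (fapp .flatten τ (.app s (fapp .lift σ (num 0))))
  | flatten_all {Δ : List Kind} {κ : Kind} {ρ : Ty Δ} {σ : Ty (κ :: Δ)}
      (h : ρ.BetaEq (.all κ σ)) (s : Tm Δ) :
      Red (.app (.tapp (.sym .flatten) ρ) s)
        (fapp .flatten (σ.inst (.chi κ)) (.tapp s (.chi κ : TyCon Δ κ)))
  | lift_nat {Δ : List Kind} {ρ : Ty Δ} (h : ρ.BetaEq .nat) (s : Tm Δ) :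
      Red (.app (.tapp (.sym .lift) ρ) s) s
  | lift_arrow {Δ : List Kind} {ρ σ τ : Ty Δ} (h : ρ.BetaEq (.arrow σ τ)) (s : Tm Δ) :
      Red (.app (.tapp (.sym .lift) ρ) s) (.abs σ (fapp .lift τ s.weaken))
  | lift_all {Δ : List Kind} {κ : Kind} {ρ : Ty Δ} {σ : Ty (κ :: Δ)}
      (h : ρ.BetaEq (.all κ σ)) (s : Tm Δ) :
      Red (.app (.tapp (.sym .lift) ρ) s) (.tabs κ (fapp .lift σ (s.tweaken κ)))

theorem Equiv.fapp {Δ : List Kind} {f : FSym} {ρ ρ' : Ty Δ} {s s' : Tm Δ}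
    (h : TyCon.BetaEq ρ ρ') (hs : Equiv s s') : Equiv (fapp f ρ s) (fapp f ρ' s') :=
  .app (.tapp (.sym f) h) hs

theorem Equiv.fapp₂ {Δ : List Kind} {f : FSym} {ρ ρ' : Ty Δ} {s s' t t' : Tm Δ}
    (h : TyCon.BetaEq ρ ρ') (hs : Equiv s s') (ht : Equiv t t') :
    Equiv (fapp₂ f ρ s t) (fapp₂ f ρ' s' t') :=
  .app (.fapp h hs) ht

theorem Equiv.exists_eq_fapp {Δ : List Kind} {f : FSym} {ρ : Ty Δ} {s u : Tm Δ}
    (h : Equiv u (Tm.fapp f ρ s)) :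
    ∃ ρ' s', u = Tm.fapp f ρ' s' ∧ TyCon.BetaEq ρ' ρ ∧ Equiv s' s := by
  cases h with | app h hs =>
  cases h with | tapp h hρ =>
  cases h
  exact ⟨_, _, rfl, hρ, hs⟩

theorem Equiv.exists_eq_fapp₂ {Δ : List Kind} {f : FSym} {ρ : Ty Δ} {s t u : Tm Δ}
    (h : Equiv u (Tm.fapp₂ f ρ s t)) :
    ∃ ρ' s' t', u = Tm.fapp₂ f ρ' s' t' ∧ TyCon.BetaEq ρ' ρ ∧ Equiv s' s ∧ Equiv t' t := by
  cases h with | app h ht =>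
  obtain ⟨ρ', s', rfl, hρ, hs⟩ := h.exists_eq_fapp
  exact ⟨_, _, _, rfl, hρ, hs, ht⟩

/-- Reduction of an arbitrary representative can be carried out on any other one. -/
theorem Step.exists_red {Δ : List Kind} {s s' t : Tm Δ} (h : Step s' t) (e : Equiv s s') :
    ∃ t', Red s t' ∧ Equiv t' t := by
  induction h with
  | abs σ _ ih =>
    cases e with | abs h e =>
    obtain ⟨t', r, e'⟩ := ih e
    exact ⟨_, .abs _ r, .abs h e'⟩
  | tabs κ _ ih =>
    cases e with | tabs e =>
    obtain ⟨t', r, e'⟩ := ih e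
    exact ⟨_, .tabs _ r, .tabs e'⟩
  | app_right u _ ih =>
    cases e with | app e₁ e₂ =>
    obtain ⟨t', r, e'⟩ := ih e₂
    exact ⟨_, .app_right _ r, .app e₁ e'⟩
  | app_left u _ ih =>
    cases e with | app e₁ e₂ =>
    obtain ⟨t', r, e'⟩ := ih e₁
    exact ⟨_, .app_left _ r, .app e' e₂⟩
  | tapp φ _ ih =>
    cases e with | tapp e h =>
    obtain ⟨t', r, e'⟩ := ih e
    exact ⟨_, .tapp _ r, .tapp e' h⟩
  | beta σ s t =>
    cases e with | app e₁ e₂ =>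
    cases e₁ with | abs h e₁ =>
    exact ⟨_, .beta _ _ _, e₁.inst e₂⟩
  | tbeta s φ =>
    cases e with | tapp e h =>
    cases e with | tabs e =>
    exact ⟨_, .tbeta _ _, e.tinst h⟩
  | plus_nat n m =>
    obtain ⟨ρ, _, _, rfl, h, ⟨⟩, ⟨⟩⟩ := e.exists_eq_fapp₂
    exact ⟨_, .plus_nat h _ _, .rfl' _⟩
  | times_nat n m =>
    obtain ⟨ρ, _, _, rfl, h, ⟨⟩, ⟨⟩⟩ := e.exists_eq_fapp₂
    exact ⟨_, .times_nat h _ _, .rfl' _⟩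
  | circ_arrow hf σ τ s t =>
    obtain ⟨ρ, s', t', rfl, h, e₁, e₂⟩ := e.exists_eq_fapp₂
    exact ⟨_, .circ_arrow hf h _ _,
      .abs .rfl (.fapp₂ .rfl (.app e₁.weaken (.var 0)) (.app e₂.weaken (.var 0)))⟩
  | circ_all hf κ σ s t =>
    obtain ⟨ρ, s', t', rfl, h, e₁, e₂⟩ := e.exists_eq_fapp₂
    exact ⟨_, .circ_all hf h _ _,
      .tabs (.fapp₂ .rfl (.tapp e₁.tweaken .rfl) (.tapp e₂.tweaken .rfl))⟩
  | flatten_nat s =>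
    obtain ⟨ρ, s', rfl, h, e⟩ := e.exists_eq_fapp
    exact ⟨_, .flatten_nat h _, e⟩
  | flatten_arrow σ τ s =>
    obtain ⟨ρ, s', rfl, h, e⟩ := e.exists_eq_fapp
    exact ⟨_, .flatten_arrow h _, .fapp .rfl (.app e (.rfl' _))⟩
  | flatten_all κ σ s =>
    obtain ⟨ρ, s', rfl, h, e⟩ := e.exists_eq_fapp
    exact ⟨_, .flatten_all h _, .fapp .rfl (.tapp e .rfl)⟩
  | lift_nat s =>
    obtain ⟨ρ, s', rfl, h, e⟩ := e.exists_eq_fapp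
    exact ⟨_, .lift_nat h _, e⟩
  | lift_arrow σ τ s =>
    obtain ⟨ρ, s', rfl, h, e⟩ := e.exists_eq_fapp
    exact ⟨_, .lift_arrow h _, .abs .rfl (.fapp .rfl e.weaken)⟩
  | lift_all κ σ s =>
    obtain ⟨ρ, s', rfl, h, e⟩ := e.exists_eq_fapp
    exact ⟨_, .lift_all h _, .tabs (.fapp .rfl e.tweaken)⟩

theorem Red.subst {Δ : List Kind} {s t : Tm Δ} (h : Red s t) (γ : ℕ → Tm Δ) :
    Red (s.subst γ) (t.subst γ) := by
  induction h with
  | abs σ _ ih => exact .abs _ (ih _)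
  | tabs κ _ ih => exact .tabs _ (ih _)
  | app_right u _ ih => exact .app_right _ (ih _)
  | app_left u _ ih => exact .app_left _ (ih _)
  | tapp φ _ ih => exact .tapp _ (ih _)
  | beta σ s t => rw [subst_inst]; exact .beta _ _ _
  | tbeta s φ => rw [← subst_tinst]; exact .tbeta _ _
  | plus_nat h n m => exact .plus_nat h _ _
  | times_nat h n m => exact .times_nat h _ _
  | circ_arrow hf h s t =>
    simp only [Tm.subst, fapp₂, fapp, subst_weaken]
    exact .circ_arrow hf h _ _
  | circ_all hf h s t =>
    simp only [Tm.subst, fapp₂, fapp, subst_tweaken]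
    exact .circ_all hf h _ _
  | flatten_nat h s => exact .flatten_nat h _
  | flatten_arrow h s => exact .flatten_arrow h _
  | flatten_all h s => exact .flatten_all h _
  | lift_nat h s => exact .lift_nat h _
  | lift_arrow h s =>
    simp only [Tm.subst, fapp, subst_weaken]
    exact .lift_arrow h _
  | lift_all h s =>
    simp only [Tm.subst, fapp, subst_tweaken]
    exact .lift_all h _

theorem Red.tsubst {Δ Δ' : List Kind} {s t : Tm Δ} (h : Red s t) (θ : TSub Δ Δ') :
    Red (s.tsubst θ) (t.tsubst θ) := by
  induction h generalizing Δ' with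
  | abs σ _ ih => exact .abs _ (ih _)
  | tabs κ _ ih => exact .tabs _ (ih _)
  | app_right u _ ih => exact .app_right _ (ih _)
  | app_left u _ ih => exact .app_left _ (ih _)
  | tapp φ _ ih => exact .tapp _ (ih _)
  | beta σ s t => rw [tsubst_inst]; exact .beta _ _ _
  | tbeta s φ => rw [tsubst_tinst]; exact .tbeta _ _
  | plus_nat h n m => exact .plus_nat (h.subst θ) _ _
  | times_nat h n m => exact .times_nat (h.subst θ) _ _
  | circ_arrow hf h s t =>
    simp only [Tm.tsubst, fapp₂, fapp, tsubst_weaken]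
    exact .circ_arrow hf (h.subst θ) _ _
  | circ_all hf h s t =>
    simp only [Tm.tsubst, fapp₂, fapp, tsubst_tweaken]
    exact .circ_all hf (h.subst θ) _ _
  | flatten_nat h s => exact .flatten_nat (h.subst θ) _
  | flatten_arrow h s => exact .flatten_arrow (h.subst θ) _
  | flatten_all h s =>
    simp only [Tm.tsubst, fapp, TyCon.subst_inst, TyCon.subst_chi]
    exact .flatten_all (h.subst θ) _
  | lift_nat h s => exact .lift_nat (h.subst θ) _
  | lift_arrow h s =>
    simp only [Tm.tsubst, fapp, tsubst_weaken]
    exact .lift_arrow (h.subst θ) _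
  | lift_all h s =>
    simp only [Tm.tsubst, fapp, tsubst_tweaken]
    exact .lift_all (h.subst θ) _

end Tm

/-! ### Strong normalisation -/

namespace Tm

/-- Strong normalisation with respect to `Red`, as accessibility. -/
def SN {Δ : List Kind} (s : Tm Δ) : Prop := Acc (fun t s => Red s t) s

theorem SN.intro {Δ : List Kind} {s : Tm Δ} (h : ∀ t, Red s t → SN t) : SN s := Acc.intro s h

theorem SN.red {Δ : List Kind} {s t : Tm Δ} (h : SN s) (r : Red s t) : SN t := h.inv r

/-- Strong normalisation is reflected by maps that preserve single reductions. -/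
theorem SN.of_map {Δ Δ' : List Kind} (f : Tm Δ → Tm Δ')
    (hf : ∀ s t, Red s t → Red (f s) (f t)) {s : Tm Δ} (h : SN (f s)) : SN s := by
  generalize hs : f s = s' at h
  induction h generalizing s with
  | intro s' _ ih =>
    subst hs
    exact .intro fun t r => ih _ (hf _ _ r) rfl

theorem SN.of_subst {Δ : List Kind} {s : Tm Δ} {γ : ℕ → Tm Δ} (h : SN (s.subst γ)) : SN s :=
  h.of_map (fun s => s.subst γ) fun _ _ r => r.subst γ

theorem SN.of_tsubst {Δ Δ' : List Kind} {s : Tm Δ} {θ : TSub Δ Δ'} (h : SN (s.tsubst θ)) :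
    SN s :=
  h.of_map (fun s => s.tsubst θ) fun _ _ r => r.tsubst θ

theorem SN.of_app_left {Δ : List Kind} {s t : Tm Δ} (h : SN (.app s t)) : SN s :=
  h.of_map (fun s => .app s t) fun _ _ r => .app_left t r

theorem SN.of_tapp {Δ : List Kind} {κ : Kind} {s : Tm Δ} {φ : TyCon Δ κ}
    (h : SN (.tapp s φ)) : SN s :=
  h.of_map (fun s => .tapp s φ) fun _ _ r => .tapp φ r

theorem sn_num {Δ : List Kind} (n : ℕ) : SN (num n : Tm Δ) := .intro fun _ r => by cases r

/-- Expressions `s` for which no redex arises at the root of `s t u₁ ⋯ uₙ` or `(s * φ) u₁ ⋯ uₙ`.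
Bare symbols and their type instances are excluded, being heads of redexes, and so is `f_τ s` for
binary `f`, which waits for one more argument. -/
def Neutral {Δ : List Kind} : Tm Δ → Prop
  | .sym _ => False
  | .abs _ _ => False
  | .tabs _ _ => False
  | .tapp (.sym _) _ => False
  | .app (.tapp (.sym f) _) _ => ¬ f.IsBinary
  | _ => True

theorem Neutral.app {Δ : List Kind} {s : Tm Δ} (h : Neutral s) (t : Tm Δ) :
    Neutral (.app s t) := by
  unfold Neutral
  split <;> simp_all [Neutral]

theorem Neutral.tapp {Δ : List Kind} {κ : Kind} {s : Tm Δ} (h : Neutral s) (φ : TyCon Δ κ) :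
    Neutral (.tapp s φ) := by
  unfold Neutral
  split <;> simp_all [Neutral]

theorem Neutral.red_app {Δ : List Kind} {s t r : Tm Δ} (h : Neutral s) (hr : Red (.app s t) r) :
    (∃ s', Red s s' ∧ r = .app s' t) ∨ ∃ t', Red t t' ∧ r = .app s t' := by
  cases hr with
  | app_left _ hs => exact .inl ⟨_, hs, rfl⟩
  | app_right _ ht => exact .inr ⟨_, ht, rfl⟩
  | plus_nat => exact absurd FSym.IsBinary.plus h
  | times_nat => exact absurd FSym.IsBinary.times h
  | circ_arrow hf => exact absurd hf h
  | circ_all hf => exact absurd hf h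
  | _ => exact h.elim

theorem Neutral.red_tapp {Δ : List Kind} {κ : Kind} {s r : Tm Δ} {φ : TyCon Δ κ} (h : Neutral s)
    (hr : Red (.tapp s φ) r) : ∃ s', Red s s' ∧ r = .tapp s' φ := by
  cases hr with
  | tapp _ hs => exact ⟨_, hs, rfl⟩
  | tbeta => exact h.elim

end Tm

open Tm

/-! ### Reducibility candidates -/

/-- Girard's three closure conditions on a set of expressions. The expressions have no free type
constructor variables, but may have free term variables and need not be typable. -/
structure IsSaturated (X : Set (Tm [])) : Prop where
  sn : ∀ s ∈ X, SN s
  red : ∀ s ∈ X, ∀ t, Red s t → t ∈ X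
  neutral : ∀ s, Neutral s → (∀ t, Red s t → t ∈ X) → s ∈ X

theorem isSaturated_sn : IsSaturated {s | SN s} where
  sn _ h := h
  red _ h _ r := SN.red h r
  neutral _ _ h := .intro h

theorem IsSaturated.var_mem {X : Set (Tm [])} (hX : IsSaturated X) (i : ℕ) : .var i ∈ X :=
  hX.neutral _ trivial fun _ r => by cases r

/-- The expressions that map `X` to `Y` by application. -/
def arrowSet (X Y : Set (Tm [])) : Set (Tm []) := {s | ∀ t ∈ X, .app s t ∈ Y}

/-- The expressions whose instances at every type constructor `ψ` lie in `F A`, for every semantic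
object `A` related to `ψ` by `R`. -/
def allSet {κ : Kind} {S : Type} (R : TyCon [] κ → S → Prop) (F : S → Set (Tm [])) :
    Set (Tm []) :=
  {s | ∀ ψ A, R ψ A → .tapp s ψ ∈ F A}

theorem isSaturated_arrowSet {X Y : Set (Tm [])} (hX : IsSaturated X) (hY : IsSaturated Y) :
    IsSaturated (arrowSet X Y) where
  sn _ h := (hY.sn _ (h _ (hX.var_mem 0))).of_app_left
  red _ h _ r u hu := hY.red _ (h u hu) _ (.app_left u r)
  neutral s hs h u hu := by
    have := hX.sn u hu
    induction this with
    | intro u _ ih =>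
      -- A neutral `s` makes every reduct of `s u` come from a reduct of `s` or of `u`.
      refine hY.neutral _ (hs.app u) fun r hr => ?_
      rcases hs.red_app hr with ⟨s', hr', rfl⟩ | ⟨u', hr', rfl⟩
      · exact h _ hr' _ hu
      · exact ih _ hr' (hX.red _ hu _ hr')

theorem isSaturated_allSet {κ : Kind} {S : Type} {R : TyCon [] κ → S → Prop}
    {F : S → Set (Tm [])} (hF : ∀ ψ A, R ψ A → IsSaturated (F A)) (hR : ∃ ψ A, R ψ A) :
    IsSaturated (allSet R F) where
  sn _ h :=
    have ⟨ψ, A, hA⟩ := hR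
    ((hF ψ A hA).sn _ (h ψ A hA)).of_tapp
  red _ h _ r ψ A hA := (hF ψ A hA).red _ (h ψ A hA) _ (.tapp ψ r)
  neutral s hs h ψ A hA := by
    refine (hF ψ A hA).neutral _ (hs.tapp ψ) fun r hr => ?_
    obtain ⟨s', hr', rfl⟩ := hs.red_tapp hr
    exact h _ hr' ψ A hA

/-- The induction is on strong normalisation of the body, and then of the argument. -/
theorem abs_mem_arrowSet {X Y : Set (Tm [])} (hX : IsSaturated X) (hY : IsSaturated Y)
    {σ : Ty []} {s : Tm []} (h : ∀ u ∈ X, s.inst u ∈ Y) : .abs σ s ∈ arrowSet X Y := by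
  intro u hu
  -- Reductions of the body carry over to its instance at a variable, and variables lie in `X`.
  have hs : SN s := (hY.sn _ (h _ (hX.var_mem 0))).of_subst
  induction hs generalizing u with
  | intro s _ ihs =>
    have := hX.sn u hu
    induction this with
    | intro u _ ihu =>
      refine hY.neutral _ trivial fun r hr => ?_
      cases hr with
      | app_left _ hr =>
        cases hr with
        | abs _ hr => exact ihs _ hr (fun v hv => hY.red _ (h v hv) _ (hr.subst _)) u hu
      | app_right _ hr => exact ihu _ hr (hX.red _ hu _ hr)
      | beta => exact h u hu

theorem tabs_mem_allSet {κ : Kind} {S : Type} {R : TyCon [] κ → S → Prop}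
    {F : S → Set (Tm [])} (hF : ∀ ψ A, R ψ A → IsSaturated (F A)) (hR : ∃ ψ A, R ψ A)
    {s : Tm [κ]} (h : ∀ ψ A, R ψ A → s.tinst ψ ∈ F A) : .tabs κ s ∈ allSet R F := by
  intro ψ A hA
  have hs : SN s :=
    have ⟨ψ, A, hA⟩ := hR
    ((hF ψ A hA).sn _ (h ψ A hA)).of_tsubst
  induction hs with
  | intro s _ ih =>
    refine (hF ψ A hA).neutral _ trivial fun r hr => ?_
    cases hr with
    | tapp _ hr =>
      cases hr with
      | tabs _ hr => exact ih _ hr fun ψ A hA => (hF ψ A hA).red _ (h ψ A hA) _ (hr.tsubst _)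
    | tbeta => exact h ψ A hA

/-- Membership of `f_ρ s t` in a saturated set, for binary `f`: only the reducts at the root
matter. -/
theorem IsSaturated.fapp₂_mem {X : Set (Tm [])} (hX : IsSaturated X) {f : FSym}
    (hf : f.IsBinary) {ρ : Ty []}
    (hnat : ρ.BetaEq .nat → ∀ n, num n ∈ X)
    (harrow : ∀ σ τ, ρ.BetaEq (.arrow σ τ) → ∀ s ∈ X, ∀ t ∈ X,
      .abs σ (fapp₂ f τ (.app s.weaken (.var 0)) (.app t.weaken (.var 0))) ∈ X)
    (hall : ∀ κ (σ : Ty [κ]), ρ.BetaEq (.all κ σ) → ∀ s ∈ X, ∀ t ∈ X,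
      .tabs κ (fapp₂ f σ (.tapp (s.tweaken κ) (.var (.zero (κ := κ))))
        (.tapp (t.tweaken κ) (.var (.zero (κ := κ))))) ∈ X)
    {s t : Tm []} (hs : s ∈ X) (ht : t ∈ X) : fapp₂ f ρ s t ∈ X := by
  have sn := hX.sn s hs
  induction sn generalizing t with
  | intro s _ ihs =>
    have := hX.sn t ht
    induction this with
    | intro t _ iht =>
      refine hX.neutral _ trivial fun r hr => ?_
      cases hr with
      | app_left _ hr =>
        cases hr with
        | app_left _ hr => cases hr with | tapp _ hr => cases hr
        | app_right _ hr => exact ihs _ hr (hX.red _ hs _ hr) ht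
        | _ => cases hf
      | app_right _ hr => exact iht _ hr (hX.red _ ht _ hr)
      | plus_nat h => exact hnat h _
      | times_nat h => exact hnat h _
      | circ_arrow _ h => exact harrow _ _ h _ hs _ ht
      | circ_all _ h => exact hall _ _ h _ hs _ ht

/-- Strong normalisation of `flatten_ρ s`: only the reducts at the root matter. -/
theorem IsSaturated.sn_flatten {X : Set (Tm [])} (hX : IsSaturated X) {ρ : Ty []}
    (harrow : ∀ σ τ, ρ.BetaEq (.arrow σ τ) → ∀ s ∈ X,
      SN (fapp .flatten τ (.app s (fapp .lift σ (num 0)))))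
    (hall : ∀ κ (σ : Ty [κ]), ρ.BetaEq (.all κ σ) → ∀ s ∈ X,
      SN (fapp .flatten (σ.inst (.chi κ)) (.tapp s (.chi κ : TyCon [] κ))))
    {s : Tm []} (hs : s ∈ X) : SN (fapp .flatten ρ s) := by
  have := hX.sn s hs
  induction this with
  | intro s _ ih =>
    refine .intro fun r hr => ?_
    cases hr with
    | app_left _ hr => cases hr with | tapp _ hr => cases hr
    | app_right _ hr => exact ih _ hr (hX.red _ hs _ hr)
    | flatten_nat => exact hX.sn _ hs
    | flatten_arrow h => exact harrow _ _ h _ hs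
    | flatten_all h => exact hall _ _ h _ hs

/-- Membership of `lift_ρ s` in a saturated set: only the reducts at the root matter. -/
theorem IsSaturated.lift_mem {X : Set (Tm [])} (hX : IsSaturated X) {ρ : Ty []}
    (hnat : ρ.BetaEq .nat → ∀ s, SN s → s ∈ X)
    (harrow : ∀ σ τ, ρ.BetaEq (.arrow σ τ) → ∀ s, SN s → .abs σ (fapp .lift τ s.weaken) ∈ X)
    (hall : ∀ κ (σ : Ty [κ]), ρ.BetaEq (.all κ σ) → ∀ s, SN s →
      .tabs κ (fapp .lift σ (s.tweaken κ)) ∈ X)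
    {s : Tm []} (hs : SN s) : fapp .lift ρ s ∈ X := by
  have hs' := hs
  induction hs' with
  | intro s _ ih =>
    refine hX.neutral _ (fun h => by cases h) fun r hr => ?_
    cases hr with
    | app_left _ hr => cases hr with | tapp _ hr => cases hr
    | app_right _ hr => exact ih _ hr (hs.red hr)
    | lift_nat h => exact hnat h _ hs
    | lift_arrow h => exact harrow _ _ h _ hs
    | lift_all h => exact hall _ _ h _ hs

/-- `X` is a candidate for the closed type `τ`: it is saturated and closed under the function
symbols at every type convertible to `τ`. -/
structure IsCandidate (τ : Ty []) (X : Set (Tm [])) : Prop extends IsSaturated X where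
  fapp₂_mem : ∀ {f : FSym}, f.IsBinary → ∀ {ρ : Ty []}, ρ.BetaEq τ → ∀ {s t : Tm []},
    s ∈ X → t ∈ X → fapp₂ f ρ s t ∈ X
  sn_flatten : ∀ {ρ : Ty []}, ρ.BetaEq τ → ∀ {s : Tm []}, s ∈ X → SN (fapp .flatten ρ s)
  lift_mem : ∀ {ρ : Ty []}, ρ.BetaEq τ → ∀ {s : Tm []}, SN s → fapp .lift ρ s ∈ X

theorem IsCandidate.congr {τ τ' : Ty []} {X : Set (Tm [])} (h : IsCandidate τ X)
    (e : τ.BetaEq τ') : IsCandidate τ' X where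
  toIsSaturated := h.toIsSaturated
  fapp₂_mem hf _ hρ := h.fapp₂_mem hf (hρ.trans e.symm)
  sn_flatten hρ := h.sn_flatten (hρ.trans e.symm)
  lift_mem hρ := h.lift_mem (hρ.trans e.symm)

theorem isCandidate_nat : IsCandidate .nat {s | SN s} where
  toIsSaturated := isSaturated_sn
  fapp₂_mem hf _ hρ _ _ := isSaturated_sn.fapp₂_mem hf (fun _ n => sn_num n)
    (fun _ _ h => (TyCon.not_betaEq_nat_arrow (hρ.symm.trans h)).elim)
    (fun _ _ h => (TyCon.not_betaEq_nat_all (hρ.symm.trans h)).elim)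
  sn_flatten hρ _ := isSaturated_sn.sn_flatten
    (fun _ _ h => (TyCon.not_betaEq_nat_arrow (hρ.symm.trans h)).elim)
    (fun _ _ h => (TyCon.not_betaEq_nat_all (hρ.symm.trans h)).elim)
  lift_mem hρ _ := isSaturated_sn.lift_mem (fun _ _ h => h)
    (fun _ _ h => (TyCon.not_betaEq_nat_arrow (hρ.symm.trans h)).elim)
    (fun _ _ h => (TyCon.not_betaEq_nat_all (hρ.symm.trans h)).elim)

theorem isCandidate_arrowSet {σ τ : Ty []} {X Y : Set (Tm [])} (hX : IsCandidate σ X)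
    (hY : IsCandidate τ Y) : IsCandidate (.arrow σ τ) (arrowSet X Y) := by
  have sat := isSaturated_arrowSet hX.toIsSaturated hY.toIsSaturated
  refine ⟨sat, fun {f} hf ρ hρ s t => ?_, fun {ρ} hρ s => ?_, fun {ρ} hρ s => ?_⟩
  · refine sat.fapp₂_mem hf
      (fun h => (TyCon.not_betaEq_nat_arrow (h.symm.trans hρ)).elim) (fun σ' τ' h s hs t ht => ?_)
      (fun _ _ h => (TyCon.not_betaEq_arrow_all (hρ.symm.trans h)).elim)
    refine abs_mem_arrowSet hX.toIsSaturated hY.toIsSaturated fun u hu => ?_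
    have : (fapp₂ f τ' (.app s.weaken (.var 0)) (.app t.weaken (.var 0))).inst u =
        fapp₂ f τ' (.app s u) (.app t u) := by
      have hw (s : Tm []) : s.weaken.subst (subSingle u) = s := inst_weaken s u
      simp [fapp₂, fapp, Tm.inst, Tm.subst, hw, subSingle]
    rw [this]
    exact hY.fapp₂_mem hf (h.symm.trans hρ).arrow_inj.2 (hs u hu) (ht u hu)
  · refine sat.sn_flatten (fun σ' τ' h s hs => ?_)
      (fun _ _ h => (TyCon.not_betaEq_arrow_all (hρ.symm.trans h)).elim)
    have e := (h.symm.trans hρ).arrow_inj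
    exact hY.sn_flatten e.2 (hs _ (hX.lift_mem e.1 (sn_num 0)))
  · refine sat.lift_mem (fun h => (TyCon.not_betaEq_nat_arrow (h.symm.trans hρ)).elim)
      (fun σ' τ' h s hs => ?_)
      (fun _ _ h => (TyCon.not_betaEq_arrow_all (hρ.symm.trans h)).elim)
    refine abs_mem_arrowSet hX.toIsSaturated hY.toIsSaturated fun u _ => ?_
    have : (fapp .lift τ' s.weaken).inst u = fapp .lift τ' s :=
      congrArg (fapp .lift τ') (inst_weaken s u)
    rw [this]
    exact hY.lift_mem (h.symm.trans hρ).arrow_inj.2 hs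

theorem isCandidate_allSet {κ : Kind} {S : Type} {R : TyCon [] κ → S → Prop}
    {F : S → Set (Tm [])} {σ : Ty [κ]} (hF : ∀ ψ A, R ψ A → IsCandidate (σ.inst ψ) (F A))
    (hR : ∃ A, R (.chi κ) A) : IsCandidate (.all κ σ) (allSet R F) := by
  have hF' ψ A hA := (hF ψ A hA).toIsSaturated
  have hR' : ∃ ψ A, R ψ A := ⟨_, hR⟩
  have sat := isSaturated_allSet hF' hR'
  refine ⟨sat, fun {f} hf ρ hρ s t => ?_, fun {ρ} hρ s => ?_, fun {ρ} hρ s => ?_⟩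
  · refine sat.fapp₂_mem hf
      (fun h => (TyCon.not_betaEq_nat_all (h.symm.trans hρ)).elim)
      (fun _ _ h => (TyCon.not_betaEq_arrow_all (h.symm.trans hρ)).elim)
      (fun κ' σ' h s hs t ht => ?_)
    obtain rfl := (h.symm.trans hρ).all_kind
    refine tabs_mem_allSet hF' hR' fun ψ A hA => ?_
    have : (fapp₂ f σ' (.tapp (s.tweaken κ') (.var (.zero (κ := κ'))))
        (.tapp (t.tweaken κ') (.var (.zero (κ := κ'))))).tinst ψ =
        fapp₂ f (σ'.inst ψ) (.tapp s ψ) (.tapp t ψ) := by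
      have hw (s : Tm []) : (s.tweaken κ').tsubst (TSub.single ψ) = s := tinst_tweaken s ψ
      simp [fapp₂, fapp, Tm.tinst, Tm.tsubst, hw, TyCon.subst, TyCon.inst, TSub.single]
    rw [this]
    exact (hF ψ A hA).fapp₂_mem hf ((h.symm.trans hρ).all_inj.subst _) (hs ψ A hA) (ht ψ A hA)
  · refine sat.sn_flatten (fun _ _ h => (TyCon.not_betaEq_arrow_all (h.symm.trans hρ)).elim)
      (fun κ' σ' h s hs => ?_)
    obtain rfl := (h.symm.trans hρ).all_kind
    obtain ⟨A, hA⟩ := hR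
    exact (hF _ A hA).sn_flatten ((h.symm.trans hρ).all_inj.subst _) (hs _ A hA)
  · refine sat.lift_mem (fun h => (TyCon.not_betaEq_nat_all (h.symm.trans hρ)).elim)
      (fun _ _ h => (TyCon.not_betaEq_arrow_all (h.symm.trans hρ)).elim)
      (fun κ' σ' h s hs => ?_)
    obtain rfl := (h.symm.trans hρ).all_kind
    refine tabs_mem_allSet hF' hR' fun ψ A hA => ?_
    have : (fapp .lift σ' (s.tweaken κ')).tinst ψ = fapp .lift (σ'.inst ψ) s :=
      congrArg (fapp .lift (σ'.inst ψ)) (tinst_tweaken s ψ)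
    rw [this]
    exact (hF ψ A hA).lift_mem ((h.symm.trans hρ).all_inj.subst _) hs

/-! ### Interpretation of type constructors -/

/-- The semantic domain of a kind: sets of expressions at `∗`, all functions at `κ₁ ⇒ κ₂`. -/
def Sem : Kind → Type
  | .star => Set (Tm [])
  | .arr κ₁ κ₂ => Sem κ₁ → Sem κ₂

/-- The logical relation between closed type constructors and semantic objects that extends
`IsCandidate` to all kinds. -/
def Realizes : (κ : Kind) → TyCon [] κ → Sem κ → Prop
  | .star, τ, X => IsCandidate τ X
  | .arr κ₁ κ₂, φ, F => ∀ ψ A, Realizes κ₁ ψ A → Realizes κ₂ (.app φ ψ) (F A)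

theorem Realizes.congr {κ : Kind} {φ φ' : TyCon [] κ} {A : Sem κ} (h : Realizes κ φ A)
    (e : φ.BetaEq φ') : Realizes κ φ' A := by
  induction κ with
  | star => exact IsCandidate.congr h e
  | arr κ₁ κ₂ _ ih => exact fun ψ B hB => ih (h ψ B hB) (.app e .rfl)

/-- At `κ₁ ⇒ κ₂` the constant function serves, as `χ` applied to anything beta-reduces to `χ_κ₂`. -/
theorem exists_realizes_chi (κ : Kind) : ∃ A, Realizes κ (.chi κ) A := by
  induction κ with
  | star => exact ⟨{s | SN s}, isCandidate_nat⟩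
  | arr κ₁ κ₂ _ ih =>
    obtain ⟨A, hA⟩ := ih
    refine ⟨fun _ => A, fun ψ _ _ => hA.congr (.symm (.rel _ _ ?_))⟩
    have := TyCon.BetaStep.beta (TyCon.chi κ₂) ψ
    rwa [TyCon.inst, TyCon.subst_chi] at this

/-- Assignments of semantic objects to type constructor variables. -/
abbrev Env (Δ : List Kind) : Type := ∀ κ : Kind, TVar Δ κ → Sem κ

/-- Extension of an assignment by the value of the variable with index `0`. -/
def Env.cons {Δ : List Kind} {κ₀ : Kind} (A : Sem κ₀) (ξ : Env Δ) : Env (κ₀ :: Δ)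
  | _, .zero => A
  | κ, .succ α => ξ κ α

/-- The value of a type constructor under an assignment. It does not refer to the type
constructors that are substituted for the free variables, so that beta-convertible type
constructors have equal values. -/
def interp : {Δ : List Kind} → {κ : Kind} → TyCon Δ κ → Env Δ → Sem κ
  | _, κ, .var α, ξ => ξ κ α
  | _, _, .nat, _ => {s : Tm [] | SN s}
  | _, _, .arrow σ τ, ξ => arrowSet (interp σ ξ) (interp τ ξ)
  | _, _, .all κ σ, ξ => allSet (Realizes κ) fun A => interp σ (ξ.cons A)
  | _, _, .lam _ φ, ξ => fun A => interp φ (ξ.cons A)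
  | _, _, .app φ ψ, ξ => (interp φ ξ : Sem _ → Sem _) (interp ψ ξ)

/-- The value of a type, as a set of expressions. -/
abbrev interpTy {Δ : List Kind} (σ : Ty Δ) (ξ : Env Δ) : Set (Tm []) := interp σ ξ

theorem interp_rename {Δ Δ' : List Kind} {κ : Kind} (φ : TyCon Δ κ) (ρ : TRen Δ Δ')
    (ξ : Env Δ') : interp (φ.rename ρ) ξ = interp φ (fun κ α => ξ κ (ρ κ α)) := by
  have up {Δ Δ' : List Kind} (ρ : TRen Δ Δ') (ξ : Env Δ') {κ₀ : Kind} (A : Sem κ₀) :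
      (fun κ α => ξ.cons A κ (ρ.up κ₀ κ α)) = Env.cons A (fun κ α => ξ κ (ρ κ α)) := by
    funext κ α
    cases α <;> rfl
  induction φ generalizing Δ' with
  | var | nat => rfl
  | arrow _ _ h₁ h₂ => exact congrArg₂ arrowSet (h₁ ρ ξ) (h₂ ρ ξ)
  | app _ _ h₁ h₂ => exact congr (h₁ ρ ξ) (h₂ ρ ξ)
  | all κ _ h =>
    exact congrArg (allSet (Realizes κ)) (funext fun A => (h _ _).trans (congrArg (interp _) (up ρ ξ A)))
  | lam _ _ h => exact funext fun A => (h _ _).trans (congrArg (interp _) (up ρ ξ A))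

theorem interp_weaken {Δ : List Kind} {κ κ₀ : Kind} (φ : TyCon Δ κ) (ξ : Env Δ) (A : Sem κ₀) :
    interp (φ.weaken κ₀) (ξ.cons A) = interp φ ξ := interp_rename φ _ _

theorem interp_subst {Δ Δ' : List Kind} {κ : Kind} (φ : TyCon Δ κ) (θ : TSub Δ Δ')
    (ξ : Env Δ') : interp (φ.subst θ) ξ = interp φ (fun κ α => interp (θ κ α) ξ) := by
  have up {Δ Δ' : List Kind} (θ : TSub Δ Δ') (ξ : Env Δ') {κ₀ : Kind} (A : Sem κ₀) :
      (fun κ α => interp (θ.up κ₀ κ α) (ξ.cons A)) =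
        Env.cons A (fun κ α => interp (θ κ α) ξ) := by
    funext κ α
    cases α with
    | zero => rfl
    | succ α => exact interp_weaken _ _ _
  induction φ generalizing Δ' with
  | var | nat => rfl
  | arrow _ _ h₁ h₂ => exact congrArg₂ arrowSet (h₁ θ ξ) (h₂ θ ξ)
  | app _ _ h₁ h₂ => exact congr (h₁ θ ξ) (h₂ θ ξ)
  | all κ _ h =>
    exact congrArg (allSet (Realizes κ)) (funext fun A => (h _ _).trans (congrArg (interp _) (up θ ξ A)))
  | lam _ _ h => exact funext fun A => (h _ _).trans (congrArg (interp _) (up θ ξ A))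

theorem interp_inst {Δ : List Kind} {κ κ₀ : Kind} (φ : TyCon (κ₀ :: Δ) κ) (ψ : TyCon Δ κ₀)
    (ξ : Env Δ) : interp (φ.inst ψ) ξ = interp φ (ξ.cons (interp ψ ξ)) := by
  rw [TyCon.inst, interp_subst]
  congr 1
  funext κ α
  cases α <;> rfl

theorem interp_eq_of_betaStep {Δ : List Kind} {κ : Kind} {φ ψ : TyCon Δ κ}
    (h : TyCon.BetaStep φ ψ) (ξ : Env Δ) : interp φ ξ = interp ψ ξ := by
  induction h with
  | beta φ ψ => exact (interp_inst φ ψ ξ).symm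
  | arrow_left τ _ ih => exact congrArg (fun X => arrowSet X (interp τ ξ)) (ih ξ)
  | arrow_right σ _ ih => exact congrArg (arrowSet (interp σ ξ)) (ih ξ)
  | @all _ κ _ _ _ ih => exact congrArg (allSet (Realizes κ)) (funext fun A => ih _)
  | lam _ ih => exact funext fun A => ih _
  | app_left ψ _ ih => exact congrFun (ih ξ) (interp ψ ξ)
  | @app_right _ κ₁ κ₂ φ _ _ _ ih => exact congrArg (interp φ ξ : Sem κ₁ → Sem κ₂) (ih ξ)

theorem interp_eq_of_betaEq {Δ : List Kind} {κ : Kind} {φ ψ : TyCon Δ κ} (h : φ.BetaEq ψ)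
    (ξ : Env Δ) : interp φ ξ = interp ψ ξ := by
  induction h with
  | rel _ _ h => exact interp_eq_of_betaStep h ξ
  | refl => rfl
  | symm _ _ _ ih => exact ih.symm
  | trans _ _ _ _ _ ih₁ ih₂ => exact ih₁.trans ih₂

theorem Realizes.cons {Δ : List Kind} {θ : TSub Δ []} {ξ : Env Δ}
    (h : ∀ κ α, Realizes κ (θ κ α) (ξ κ α)) {κ₀ : Kind} {ψ : TyCon [] κ₀} {A : Sem κ₀}
    (hA : Realizes κ₀ ψ A) (κ : Kind) (α : TVar (κ₀ :: Δ) κ) :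
    Realizes κ (TSub.cons ψ θ κ α) (ξ.cons A κ α) := by
  cases α with
  | zero => exact hA
  | succ α => exact h _ α

/-- The fundamental lemma for type constructors. -/
theorem realizes_interp {Δ : List Kind} {κ : Kind} (φ : TyCon Δ κ) {θ : TSub Δ []} {ξ : Env Δ}
    (h : ∀ κ α, Realizes κ (θ κ α) (ξ κ α)) : Realizes κ (φ.subst θ) (interp φ ξ) := by
  induction φ with
  | var α => exact h _ α
  | nat => exact isCandidate_nat
  | arrow σ τ ihσ ihτ => exact isCandidate_arrowSet (ihσ h) (ihτ h)
  | all κ σ ih =>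
    refine isCandidate_allSet (fun ψ A hA => ?_) (exists_realizes_chi κ)
    rw [TyCon.inst_subst_up]
    exact ih (Realizes.cons h hA)
  | lam κ φ ih =>
    intro ψ A hA
    have := ih (Realizes.cons h hA)
    rw [← TyCon.inst_subst_up] at this
    -- `(λα.φ)ψ` is convertible to `φ[α := ψ]`, and `Realizes` respects conversion.
    exact this.congr (.symm (.rel _ _ (.beta _ _)))
  | app φ ψ ihφ ihψ => exact ihφ h _ _ (ihψ h)

/-- The function symbols lie in the values of their types. -/
theorem sym_mem_interp {Δ : List Kind} (f : FSym) (ξ : Env Δ) :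
    .sym f ∈ interpTy f.type ξ := by
  cases f with
  | num n => exact sn_num n
  | plus => exact fun ψ A (hA : IsCandidate ψ A) s hs t ht => hA.fapp₂_mem .plus .rfl hs ht
  | times => exact fun ψ A (hA : IsCandidate ψ A) s hs t ht => hA.fapp₂_mem .times .rfl hs ht
  | flatten => exact fun ψ A (hA : IsCandidate ψ A) s hs => hA.sn_flatten .rfl hs
  | lift => exact fun ψ A (hA : IsCandidate ψ A) s hs => hA.lift_mem .rfl hs

/-- The fundamental lemma for expressions. -/
theorem HasType.subst_mem_interp {Δ : List Kind} {Γ : List (Ty Δ)} {s : Tm Δ} {σ : Ty Δ}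
    (h : HasType Γ s σ) {θ : TSub Δ []} {ξ : Env Δ} (hξ : ∀ κ α, Realizes κ (θ κ α) (ξ κ α))
    {γ : ℕ → Tm []} (hγ : ∀ i τ, Γ[i]? = some τ → γ i ∈ interpTy τ ξ) :
    (s.tsubst θ).subst γ ∈ interpTy σ ξ := by
  induction h generalizing γ with
  | var h => exact hγ _ _ h
  | sym f => exact sym_mem_interp f ξ
  | @abs Δ Γ σ τ s _ ih =>
    have hσ : IsCandidate _ (interpTy σ ξ) := realizes_interp σ hξ
    have hτ : IsCandidate _ (interpTy τ ξ) := realizes_interp τ hξ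
    refine abs_mem_arrowSet hσ.toIsSaturated hτ.toIsSaturated fun u hu => ?_
    rw [inst_subst_up]
    refine ih hξ fun i τ h => ?_
    cases i with
    | zero => cases h; exact hu
    | succ i => exact hγ i τ h
  | @tabs Δ Γ κ σ s _ ih =>
    refine tabs_mem_allSet (R := Realizes κ) (fun ψ A hA => IsCandidate.toIsSaturated
      (realizes_interp σ (Realizes.cons hξ hA))) ⟨.chi κ, exists_realizes_chi κ⟩ fun ψ A hA => ?_
    rw [subst_tinst, tinst_tsubst_up]
    refine ih (Realizes.cons hξ hA) fun i τ h => ?_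
    rw [List.getElem?_map, Option.map_eq_some_iff] at h
    obtain ⟨τ, h, rfl⟩ := h
    rw [interpTy, interp_weaken]
    exact hγ i τ h
  | app _ _ ih₁ ih₂ => exact ih₁ hξ hγ _ (ih₂ hξ hγ)
  | tapp φ _ ih =>
    rw [interpTy, interp_inst]
    exact ih hξ hγ _ _ (realizes_interp φ hξ)
  | conv _ e ih =>
    rw [interpTy, interp_eq_of_betaEq e]
    exact ih hξ hγ

/-- Type constructor variables are instantiated by `χ` and term variables by themselves. -/
theorem HasType.sn {Δ : List Kind} {Γ : List (Ty Δ)} {s : Tm Δ} {σ : Ty Δ}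
    (h : HasType Γ s σ) : SN s := by
  choose A hA using exists_realizes_chi
  have hξ (κ : Kind) (_ : TVar Δ κ) : Realizes κ (.chi κ) (A κ) := hA κ
  have sat (τ : Ty Δ) : IsSaturated (interpTy τ fun κ _ => A κ) :=
    IsCandidate.toIsSaturated (realizes_interp τ hξ)
  exact ((sat σ).sn _ (h.subst_mem_interp hξ fun i τ _ => (sat τ).var_mem i)).of_subst.of_tsubst

/-- An infinite reduction of classes is followed by `Red`, one representative at a time. -/
theorem Tm.SN.terminating {Δ : List Kind} {s : Tm Δ} (h : SN s) : (ITerm.mk s).Terminating := by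
  induction h with
  | intro s _ ih =>
    rintro ⟨r, h₀, hr⟩
    obtain ⟨s', t, hs', ht, hstep⟩ := hr 0
    have e : Tm.Equiv s s' := Quotient.exact (h₀.symm.trans hs'.symm)
    obtain ⟨t', hred, e'⟩ := hstep.exists_red e
    exact ih t' hred ⟨fun n => r (n + 1), ht.symm.trans (Quotient.sound e'.symm'),
      fun n => hr (n + 1)⟩

end FOmegaNat

theorem mainTheorem1 (Δ : List FOmegaNat.Kind) (Γ : List (FOmegaNat.Ty Δ))
    (t : FOmegaNat.ITerm Δ) (σ : FOmegaNat.Ty Δ)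
    (ht : FOmegaNat.ITerm.HasType Γ t σ) :
    FOmegaNat.ITerm.Terminating t := by
  obtain ⟨s, rfl, hs⟩ := ht
  exact hs.sn.terminating
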